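/- Let $D=\{(x,y)\in\mathbb{R}^2 : 9|y|\le \tfrac14-|x|\}$, $L=\left([-\tfrac{\pi}{2},-\tfrac14]\cup[\tfrac14,\tfrac{\pi}{2}]\right)\times\{0\}$ and $Y=D\cup L$, with the metric $d$ induced by the $\ell^\infty$-norm on $\mathbb{R}^2$. Let $\mathfrak n$ be the measure on $Y$ with density $\cos^2(x)\big/\tfrac{2(1/4-|x|)}{9}$ with respect to two-dimensional Lebesgue measure on $D$ and with density $\cos^2(x)$ with respect to one-dimensional Lebesgue measure on $L$. Equivalently, the projection of $\mathfrak n$ to the $x$-axis is $\cos^2(x)\,dx$ on $[-\tfrac{\pi}{2},\tfrac{\pi}{2}]$, and $\mathfrak n$ is uniformly distributed on the vertical slices of $Y$. Theorem. $(Y,d,\mathfrak n)$ is a compact geodesic metric measure space (balls of positive radius have positive finite measure), the projection of $\mathfrak n$ to the $x$-axis is $\cos^2(x)\,dx$ on $[-\tfrac{\pi}{2},\tfrac{\pi}{2}]$, $(Y,d,\mathfrak n)$ satisfies $\mathsf{MCP}(2,3)$, and $\operatorname{diam}(Y)=\pi$; nevertheless $Y$ is not a topological spherical suspension. In particular, there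 exists a compact geodesic metric measure space satisfying $\mathsf{MCP}(2,3)$, with diameter $\pi$, that is not a topological spherical suspension. Here a geodesic in a metric space $X$ is a map $\gamma:[0,1]\to X$ with $d(\gamma(s),\gamma(t))=|s-t|\,d(\gamma(0),\gamma(1))$ for all $s,t$; its length is $l(\gamma)=d(\gamma(0),\gamma(1))$; $\mathrm{Geo}(X)$ is the set of all geodesics, with the Borel $\sigma$-algebra of uniform convergence; and $e_t(\gamma)=\gamma(t)$. The space $X$ is geodesic if any two of its points are the endpoints of a geodesic. A metric measure space $(X,d,\mathfrak m)$ satisfies $\mathsf{MCP}(2,3)$ if for every $x\in X$ and every Borel set $A\subset B(x,\pi)$ (open ball) with $0<\mathfrak m(A)<\infty$ there is a Borel probability measure $\Pi$ on $\mathrm{Geo}(X)$ such that $(e_0)_\sharp\Pi=\delta_x$, $(e_1)_\sharp\Pi=\mathfrak m(A)^{-1}\mathfrak m|_A$, and, for every $t\in[0,1]$, $$\mathfrak m\ \ge\ (e_t)_\sharp\left(\varsigma^{(t)}(l(\gamma))\,\mathfrak m(A)\,d\Pi(\gamma)\right),\qquad \varsigma^{(t)}(l)=t\,\frac{\sin^2(tl)}{\sin^2(l)}\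 \ (l>0),\quad \varsigma^{(t)}(0)=t^3 .$$ A topological space is a topological spherical suspension if it is homeomorphic, for some topological space $Z$, to the quotient of $Z\times[0,\pi]$ in which $Z\times\{0\}$ and $Z\times\{\pi\}$ are each collapsed to a point. -/

import Mathlib

open MeasureTheory

/-! ### Geodesics and the measure contraction property -/

/-- Constant speed minimal geodesics `γ : [0,1] → X`. -/
def Geo (X : Type*) [MetricSpace X] : Type _ :=
  {γ : C(unitInterval, X) //
    ∀ t s : unitInterval, dist (γ t) (γ s) = |(s : ℝ) - (t : ℝ)| * dist (γ 0) (γ 1)}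

namespace Geo

variable {X : Type*} [MetricSpace X]

/-- The topology of uniform convergence. -/
instance : TopologicalSpace (Geo X) :=
  inferInstanceAs (TopologicalSpace {γ : C(unitInterval, X) //
    ∀ t s : unitInterval, dist (γ t) (γ s) = |(s : ℝ) - (t : ℝ)| * dist (γ 0) (γ 1)})

instance : MeasurableSpace (Geo X) := borel (Geo X)

instance : BorelSpace (Geo X) := ⟨rfl⟩

/-- The evaluation map `e_t`. -/
def eval (t : unitInterval) (γ : Geo X) : X := γ.1 t

/-- The length `l(γ) = d(γ₀, γ₁)`. -/
noncomputable def length (γ : Geo X) : ℝ := dist (γ.eval 0) (γ.eval 1)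

theorem continuous_eval (t : unitInterval) : Continuous (eval t : Geo X → X) :=
  (continuous_eval_const t).comp continuous_subtype_val

theorem measurable_eval [MeasurableSpace X] [BorelSpace X] (t : unitInterval) :
    Measurable (eval t : Geo X → X) :=
  (continuous_eval t).measurable

end Geo

/-- Any two points are joined by a minimal geodesic. -/
def IsGeodesicSpace (X : Type*) [MetricSpace X] : Prop :=
  ∀ x y : X, ∃ γ : Geo X, γ.eval 0 = x ∧ γ.eval 1 = y

/-- A complete separable metric space with a Borel measure for which balls have positive and
finite measure. -/
def IsMetricMeasureSpace (X : Type*) [MetricSpace X] [MeasurableSpace X] [BorelSpace X]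
    (m : Measure X) : Prop :=
  CompleteSpace X ∧ TopologicalSpace.SeparableSpace X ∧
    ∀ (x : X) (r : ℝ), 0 < r → 0 < m (Metric.ball x r) ∧ m (Metric.ball x r) < ⊤

/-- The model functions `s_K`. -/
noncomputable def modelSin (K t : ℝ) : ℝ :=
  if 0 < K then Real.sin (√K * t) / √K
  else if K < 0 then Real.sinh (√(-K) * t) / √(-K)
  else t

/-- The coefficients `ς_{K,N}^{(t)}(d)`. For `d = 0` and `N > 1`, where the defining quotient
is `0 / 0`, the value is the limit `t ^ N` of the quotient expression as `d → 0`. -/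
noncomputable def contractionCoeff (K N t d : ℝ) : ℝ :=
  if N = 1 then t
  else if d = 0 then t ^ N
  else t * (modelSin K (t * d / √(N - 1)) / modelSin K (d / √(N - 1))) ^ (N - 1)

/-- The measure contraction property `MCP(K, N)` in the sense of Ohta. -/
def MCP (K N : ℝ) (X : Type*) [MetricSpace X] [MeasurableSpace X] [BorelSpace X]
    (m : Measure X) : Prop :=
  (1 < N ∨ (N = 1 ∧ K ≤ 0)) ∧
  ∀ (x : X) (A : Set X), MeasurableSet A → 0 < m A → m A < ⊤ →
    (0 < K → A ⊆ Metric.ball x (Real.pi * √((N - 1) / K))) →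
    ∃ P : Measure (Geo X), IsProbabilityMeasure P ∧
      P.map (Geo.eval 0) = Measure.dirac x ∧
      P.map (Geo.eval 1) = (m A)⁻¹ • m.restrict A ∧
      ∀ t : unitInterval,
        (P.withDensity fun γ =>
          ENNReal.ofReal (contractionCoeff K N t γ.length) * m A).map (Geo.eval t) ≤ m

/-! ### Topological spherical suspensions -/

/-- On `Z × [0, π]`, identify all points of `Z × {0}` with each other, and all points of
`Z × {π}` with each other. -/
def suspensionSetoid (Z : Type*) : Setoid (Z × Set.Icc (0 : ℝ) Real.pi) where
  r p q := p = q ∨ ((p.2 : ℝ) = 0 ∧ (q.2 : ℝ) = 0) ∨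
    ((p.2 : ℝ) = Real.pi ∧ (q.2 : ℝ) = Real.pi)
  iseqv :=
    { refl := fun _ => Or.inl rfl
      symm := by
        rintro p q (h | h | h)
        · exact Or.inl h.symm
        · exact Or.inr (Or.inl h.symm)
        · exact Or.inr (Or.inr h.symm)
      trans := by
        have hpi := Real.pi_pos
        rintro p q r (rfl | h | h) (rfl | h' | h')
        · exact Or.inl rfl
        · exact Or.inr (Or.inl h')
        · exact Or.inr (Or.inr h')
        · exact Or.inr (Or.inl h)
        · exact Or.inr (Or.inl ⟨h.1, h'.2⟩)
        · exact absurd (h.2.symm.trans h'.1) hpi.ne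
        · exact Or.inr (Or.inr h)
        · exact absurd (h'.1.symm.trans h.2) hpi.ne
        · exact Or.inr (Or.inr ⟨h.1, h'.2⟩) }

/-- The (unreduced) suspension of `Z`. -/
def SphericalSuspension (Z : Type*) : Type _ := Quotient (suspensionSetoid Z)

/-- The quotient topology of the product topology on `Z × [0, π]`. -/
instance (Z : Type*) [TopologicalSpace Z] : TopologicalSpace (SphericalSuspension Z) :=
  inferInstanceAs (TopologicalSpace (Quotient (suspensionSetoid Z)))

/-- `X` is homeomorphic to the suspension of some topological space `Z`. The universe of `Z` is no
restriction, since `Z` embeds in its suspension. -/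
def IsTopologicalSphericalSuspension.{u} (X : Type u) [TopologicalSpace X] : Prop :=
  ∃ (Z : Type u) (_ : TopologicalSpace Z), Nonempty (X ≃ₜ SphericalSuspension Z)

/-! ### The diamond with two segments attached -/

/-- The diamond `D`. -/
def diamond : Set (ℝ × ℝ) := {p | 9 * |p.2| ≤ 1 / 4 - |p.1|}

/-- The projection of the two segments to the first axis. -/
def segmentBase : Set ℝ :=
  Set.Icc (-(Real.pi / 2)) (-(1 / 4)) ∪ Set.Icc (1 / 4) (Real.pi / 2)

/-- The two segments `L`. -/
def segments : Set (ℝ × ℝ) := segmentBase ×ˢ {0}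

/-- The space `Y = D ∪ L`; the metric that it inherits from `ℝ × ℝ` is the `l^∞` metric. -/
abbrev DiamondSpace : Type := ↥(diamond ∪ segments)

/-- The length of the vertical slice `{y | (x, y) ∈ D}` for `|x| ≤ 1 / 4`. -/
noncomputable def sliceLength (x : ℝ) : ℝ := 2 * (1 / 4 - |x|) / 9

/-- On `D`, the measure `cos² x dx` spread uniformly over the vertical slices; on `L`, the
measure `cos² x dx`. -/
noncomputable def planeMeasure : Measure (ℝ × ℝ) :=
  ((volume : Measure (ℝ × ℝ)).restrict diamond).withDensity
      (fun p => ENNReal.ofReal (Real.cos p.1 ^ 2 / sliceLength p.1)) +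
    (((volume : Measure ℝ).restrict segmentBase).withDensity
      (fun x => ENNReal.ofReal (Real.cos x ^ 2))).map (fun x => (x, (0 : ℝ)))

/-- The measure `planeMeasure`, which lives on `Y`, as a measure on `Y`. -/
noncomputable def diamondMeasure : Measure DiamondSpace :=
  planeMeasure.comap Subtype.val

/-! ### Random geodesics -/

/-! The mechanism is a measure-preserving change of coordinates. The map `flatten`, `(x, s) ↦ (x, s
h(x))` with `h` the half height, pushes the measure `cos² x dx ds / 2` on the rectangle `[-π/2, π/2]
× [-1, 1]` forward to the measure on `Y` (`diamondMeasure_eq_map`). A transport is then a map of the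
rectangle, and contraction becomes a pointwise Jacobian inequality.

In the `ℓ^∞` metric a curve with affine first coordinate is already a geodesic when its vertical
speed never exceeds its horizontal speed. Since the diamond has slope `1/9`, this leaves much
freedom in choosing geodesics from `(a, b)` to the point with coordinates `(u, s)`. If `|u - a| < 3
h(a)`, the straight segment is taken. Otherwise the path is affine in `(x, s)` when `h(a) > 0`, and
keeps `s` constant when `h(a) = 0`. For `t > 0` the time-`t` map is triangular with Jacobian `t *
fiberSlope`, so `MCP(2,3)` reduces to `ς cos² u ≤ t * fiberSlope * cos² x_t`, where `x_t = (1 - t) a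
+ t u` (`contractionCoeff_mul_cos_sq_le_fiberSlope`).

For `h(a) = 0` the slope is `1`, and this is the one-dimensional estimate for `cos²`. For far end
points with `h(a) > 0` the slope is `t`; the lost factor is recovered because `cos a` is bounded
below, so that the term coming from `a` in the sine interpolation of `cos` is large enough. For near
end points the slope is `t h(u) / h(x_t)`; distances are at most `1/12`, so `ς` is close to `t³`,
and the spare power of `t` pays for `h(x_t) / h(u)` and for the variation of `cos`.

The topological part counts cut points. If `Z` has at least two points, only the two poles of its
suspension can be cut points, whereas every point of a segment of `Y`, apart from its outer end, is
one. If `Z` has at most one point, the suspension injects continuously into the line, which is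
impossible because `Y` contains a copy of the plane. -/

namespace Geo

variable {Ω X : Type*} [MeasurableSpace Ω] [MetricSpace X] [MeasurableSpace X] [BorelSpace X]

/-- The space of continuous curves is second countable, so an open set is a countable union of
closed balls. A closed uniform ball is cut out by conditions at countably many dense times, each
involving one evaluation only. -/
theorem measurable_of_eval [SecondCountableTopology X] {Γ : Ω → Geo X}
    (h : ∀ t, Measurable fun ω => (Γ ω).eval t) : Measurable Γ := by
  refine measurable_of_isOpen fun U hU => ?_
  obtain ⟨V, hV, rfl⟩ : ∃ V : Set C(unitInterval, X), IsOpen V ∧ Subtype.val ⁻¹' V = U :=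
    isOpen_induced_iff.1 hU
  have hball : ∀ f ∈ V, ∃ r > 0, Metric.closedBall f r ⊆ V := fun f hf =>
    Metric.nhds_basis_closedBall.mem_iff.1 (hV.mem_nhds hf)
  choose! r hr hrV using hball
  obtain ⟨T, hTV, hT, hcover⟩ := TopologicalSpace.countable_cover_nhdsWithin
    (f := fun f => Metric.closedBall f (r f)) (s := V)
    fun f hf => mem_nhdsWithin_of_mem_nhds (Metric.closedBall_mem_nhds f (hr f hf))
  have hVeq : V = ⋃ f ∈ T, Metric.closedBall f (r f) :=
    hcover.antisymm (Set.iUnion₂_subset fun f hf => hrV f (hTV hf))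
  change MeasurableSet ((fun ω => (Γ ω).1) ⁻¹' V)
  rw [hVeq, Set.preimage_iUnion₂]
  refine MeasurableSet.biUnion hT fun f hf => ?_
  obtain ⟨S, hS, hSd⟩ := TopologicalSpace.exists_countable_dense unitInterval
  have : (fun ω => (Γ ω).1) ⁻¹' Metric.closedBall f (r f) =
      ⋂ t ∈ S, {ω | dist ((Γ ω).eval t) (f t) ≤ r f} := by
    ext ω
    simp only [Set.mem_preimage, Metric.mem_closedBall, Set.mem_iInter, Set.mem_ofPred_eq]
    rw [ContinuousMap.dist_le (hr f (hTV hf)).le]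
    refine ⟨fun h t _ => h t, fun h t => ?_⟩
    have hcl : IsClosed {t | dist ((Γ ω).1 t) (f t) ≤ r f} :=
      isClosed_le (by fun_prop) continuous_const
    exact hcl.closure_subset_iff.2 (fun t ht => h t ht) (hSd t)
  rw [this]
  exact MeasurableSet.biInter hS fun t _ =>
    measurableSet_le ((h t).dist measurable_const) measurable_const

theorem measurable_length {X : Type*} [MetricSpace X] : Measurable (length : Geo X → ℝ) :=
  ((continuous_eval 0).dist (continuous_eval 1)).measurable

end Geo

theorem measurable_modelSin (K : ℝ) : Measurable (modelSin K) := by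
  unfold modelSin
  split_ifs <;> fun_prop

theorem measurable_contractionCoeff (K N t : ℝ) : Measurable (contractionCoeff K N t) := by
  unfold contractionCoeff
  have := measurable_modelSin K
  split_ifs
  · fun_prop
  · refine Measurable.ite (measurableSet_singleton 0) measurable_const ?_
    fun_prop

/-- Here `K = N - 1 = 2`, so the two rescalings of the argument of the sine cancel, as do the outer
factors `1 / √K`. -/
theorem contractionCoeff_two_three (t d : ℝ) :
    contractionCoeff 2 3 t d =
      if d = 0 then t ^ 3 else t * (Real.sin (t * d) / Real.sin d) ^ 2 := by
  have h2 : √(2 : ℝ) ≠ 0 := by positivity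
  have h3 : ((3 : ℝ) - 1) = 2 := by norm_num
  unfold contractionCoeff modelSin
  rw [h3]
  norm_num
  split_ifs
  · exact_mod_cast rfl
  · rw [mul_div_cancel₀ _ h2, mul_div_cancel₀ _ h2, div_div_div_cancel_right₀ h2]

/-- A measurable selection of geodesics from `x` to the points of a space `Ω` that parametrizes
`X` contracts every set of finite measure, if it contracts `Ω`. -/
theorem exists_contraction {Ω X : Type*} [MeasurableSpace Ω] [MetricSpace X] [MeasurableSpace X]
    [BorelSpace X] {μ : Measure Ω} {q : Ω → X} (hq : Measurable q) {K N : ℝ} {x : X}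
    {Γ : Ω → Geo X} (hΓ : Measurable Γ) (h0 : ∀ ω, (Γ ω).eval 0 = x)
    (h1 : ∀ ω, (Γ ω).eval 1 = q ω)
    (hcontr : ∀ (t : unitInterval) (B : Set X), MeasurableSet B →
      ∫⁻ ω in (fun ω => (Γ ω).eval t) ⁻¹' B,
        ENNReal.ofReal (contractionCoeff K N t (Γ ω).length) ∂μ ≤ μ.map q B)
    {A : Set X} (hA : MeasurableSet A) (hA0 : 0 < μ.map q A) (hAtop : μ.map q A < ⊤) :
    ∃ P : Measure (Geo X), IsProbabilityMeasure P ∧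
      P.map (Geo.eval 0) = Measure.dirac x ∧
      P.map (Geo.eval 1) = (μ.map q A)⁻¹ • (μ.map q).restrict A ∧
      ∀ t : unitInterval,
        (P.withDensity fun γ =>
          ENNReal.ofReal (contractionCoeff K N t γ.length) * μ.map q A).map (Geo.eval t) ≤
            μ.map q := by
  set M := μ.map q A with hM
  have hMA : M = μ (q ⁻¹' A) := Measure.map_apply hq hA
  have hprob : IsProbabilityMeasure (M⁻¹ • (μ.restrict (q ⁻¹' A)).map Γ) := by
    constructor
    rw [Measure.smul_apply, Measure.map_apply hΓ MeasurableSet.univ, Set.preimage_univ,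
      Measure.restrict_apply_univ, ← hMA, smul_eq_mul, ENNReal.inv_mul_cancel hA0.ne' hAtop.ne]
  refine ⟨M⁻¹ • (μ.restrict (q ⁻¹' A)).map Γ, hprob, ?_, ?_, fun t => ?_⟩
  · have : (M⁻¹ • (μ.restrict (q ⁻¹' A)).map Γ).map (Geo.eval 0) =
        M⁻¹ • (μ.restrict (q ⁻¹' A)).map (fun _ => x) := by
      rw [Measure.map_smul, Measure.map_map (Geo.measurable_eval 0) hΓ]
      congr 2
      exact funext h0
    rw [this, Measure.map_const, Measure.restrict_apply_univ, ← hMA, smul_smul,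
      ENNReal.inv_mul_cancel hA0.ne' hAtop.ne, one_smul]
  · rw [Measure.map_smul, Measure.map_map (Geo.measurable_eval 1) hΓ,
      Measure.restrict_map hq hA]
    congr 2
    exact funext h1
  · refine Measure.le_iff.2 fun B hB => ?_
    have hev := Geo.measurable_eval (X := X) t
    have hf : Measurable fun γ : Geo X => ENNReal.ofReal (contractionCoeff K N t γ.length) :=
      ((measurable_contractionCoeff K N t).comp Geo.measurable_length).ennreal_ofReal
    rw [Measure.map_apply hev hB, withDensity_apply _ (hev hB), Measure.restrict_smul,
      lintegral_smul_measure, lintegral_mul_const _ hf, Measure.restrict_map hΓ (hev hB),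
      lintegral_map hf hΓ, Measure.restrict_restrict (hΓ (hev hB)), smul_eq_mul,
      mul_comm _ M, ← mul_assoc, ENNReal.inv_mul_cancel hA0.ne' hAtop.ne, one_mul]
    -- The hypothesis bounds the transport of all of `μ`, so the restriction to `q ⁻¹' A` can be
    -- dropped: this only enlarges the left side.
    exact (lintegral_mono_set Set.inter_subset_left).trans (hcontr t B hB)

/-! ### Trigonometric estimates -/

/-- The function `cos` solves `f'' = -f`, so it is interpolated exactly by sines. Both sides are odd
in `u - a`, which permits the absolute values. -/
theorem sin_mul_cos_interpolate (a u t : ℝ) :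
    Real.sin |u - a| * Real.cos ((1 - t) * a + t * u) =
      Real.sin ((1 - t) * |u - a|) * Real.cos a + Real.sin (t * |u - a|) * Real.cos u := by
  have key : ∀ δ : ℝ, Real.sin δ * Real.cos (a + t * δ) =
      Real.sin ((1 - t) * δ) * Real.cos a + Real.sin (t * δ) * Real.cos (a + δ) := fun δ => by
    rw [show (1 - t) * δ = δ - t * δ by ring, Real.sin_sub, Real.cos_add, Real.cos_add]
    ring
  have h := key (u - a)
  rw [show a + t * (u - a) = (1 - t) * a + t * u by ring, add_sub_cancel] at h
  rcases abs_choice (u - a) with h' | h' <;> rw [h']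
  · exact h
  · rw [mul_neg, mul_neg, Real.sin_neg, Real.sin_neg, Real.sin_neg]
    linear_combination -h

theorem cos_nonneg_of_abs_le {x : ℝ} (hx : |x| ≤ Real.pi / 2) : 0 ≤ Real.cos x :=
  Real.cos_nonneg_of_mem_Icc (abs_le.1 hx)

theorem abs_interpolate_le {a u t r : ℝ} (ht0 : 0 ≤ t) (ht1 : t ≤ 1) (ha : |a| ≤ r)
    (hu : |u| ≤ r) : |(1 - t) * a + t * u| ≤ r := by
  rw [abs_le] at *
  constructor <;> nlinarith

theorem contractionCoeff_mul_le_of_sq_le {t l p r : ℝ} (ht : 0 ≤ t) (hl : 0 < l) (hr : 0 ≤ r)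
    (h : 0 < Real.sin l → (Real.sin (t * l)) ^ 2 * p ≤ r * (Real.sin l) ^ 2)
    (hl' : l ≤ Real.pi) : contractionCoeff 2 3 t l * p ≤ t * r := by
  rw [contractionCoeff_two_three, if_neg hl.ne', mul_assoc]
  refine mul_le_mul_of_nonneg_left ?_ ht
  rcases (Real.sin_nonneg_of_nonneg_of_le_pi hl.le hl').eq_or_lt with h0 | h0
  -- If `sin l = 0`, that is `l = π`, the quotient in the coefficient is `0` by the convention on
  -- division, and the bound is trivial.
  · simpa [← h0] using hr
  · rw [div_pow, div_mul_eq_mul_div, div_le_iff₀ (by positivity)]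
    exact h h0

theorem contractionCoeff_mul_cos_sq_le {a u t : ℝ} (ht0 : 0 ≤ t) (ht1 : t ≤ 1)
    (ha : |a| ≤ Real.pi / 2) (hu : |u| ≤ Real.pi / 2) :
    contractionCoeff 2 3 t |u - a| * Real.cos u ^ 2 ≤
      t * Real.cos ((1 - t) * a + t * u) ^ 2 := by
  rcases (abs_nonneg (u - a)).eq_or_lt with h0 | h0
  · have hua : u = a := by rwa [eq_comm, abs_eq_zero, sub_eq_zero] at h0
    rw [← h0, hua, contractionCoeff_two_three, if_pos rfl,
      show (1 - t) * a + t * a = a by ring]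
    refine mul_le_mul_of_nonneg_right ?_ (sq_nonneg _)
    simpa using pow_le_pow_of_le_one ht0 ht1 (show 1 ≤ 3 by norm_num)
  have hpi : |u - a| ≤ Real.pi := (abs_sub u a).trans (by linarith)
  refine contractionCoeff_mul_le_of_sq_le ht0 h0 (sq_nonneg _) (fun _ => ?_) hpi
  rw [← mul_pow, ← mul_pow, mul_comm (Real.cos _) (Real.sin |u - a|), sin_mul_cos_interpolate]
  have h1 : 0 ≤ Real.sin (t * |u - a|) * Real.cos u := mul_nonneg
    (Real.sin_nonneg_of_nonneg_of_le_pi (by positivity) (by nlinarith)) (cos_nonneg_of_abs_le hu)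
  have h2 : 0 ≤ Real.sin ((1 - t) * |u - a|) * Real.cos a := mul_nonneg
    (Real.sin_nonneg_of_nonneg_of_le_pi (mul_nonneg (by linarith) h0.le) (by nlinarith))
    (cos_nonneg_of_abs_le ha)
  exact pow_le_pow_left₀ h1 (by linarith) 2

theorem mul_cos_le_sin {l : ℝ} (h0 : 0 ≤ l) (h1 : l ≤ Real.pi) :
    l * Real.cos l ≤ Real.sin l := by
  rcases lt_or_ge l (Real.pi / 2) with h | h
  · have hc : 0 < Real.cos l := Real.cos_pos_of_mem_Ioo ⟨by linarith, h⟩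
    have := Real.le_tan h0 h
    rwa [Real.tan_eq_sin_div_cos, le_div_iff₀ hc] at this
  · have : Real.cos l ≤ 0 := Real.cos_nonpos_of_pi_div_two_le_of_le h (by linarith)
    nlinarith [Real.sin_nonneg_of_nonneg_of_le_pi h0 h1]

theorem mul_sin_le_sin_mul {l r : ℝ} (h0 : 0 ≤ l) (h1 : l ≤ Real.pi) (hr0 : 0 ≤ r)
    (hr1 : r ≤ 1) : r * Real.sin l ≤ Real.sin (r * l) := by
  have := strictConcaveOn_sin_Icc.concaveOn.2 (x := l) (y := 0) ⟨h0, h1⟩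
    ⟨le_rfl, Real.pi_pos.le⟩ hr0 (show 0 ≤ 1 - r by linarith) (by ring)
  simpa using this

/-- With `l = |u - a|`, expand `cos u` around `a` and use `l cos l ≤ sin l`. The remaining term is
at most `(l / 4) sin l ≤ sin l / 2 ≤ cos a sin l`, by `l ≤ 2` and `cos a ≥ 1/2`. -/
theorem mul_cos_le_two_mul_sin_mul_cos {a u : ℝ} (ha : |a| ≤ 1 / 4) (hu : |u| ≤ Real.pi / 2) :
    |u - a| * Real.cos u ≤ 2 * (Real.sin |u - a| * Real.cos a) := by
  have hpi := Real.pi_gt_three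
  have hpi' := Real.pi_lt_d2
  set l := |u - a| with hl
  have hl0 : 0 ≤ l := abs_nonneg _
  have hl2 : l ≤ 2 := (abs_sub u a).trans (by linarith)
  have hsin : 0 ≤ Real.sin l := Real.sin_nonneg_of_nonneg_of_le_pi hl0 (by linarith)
  have hsa : |Real.sin a| ≤ 1 / 4 := Real.abs_sin_le_abs.trans ha
  have hca : 1 / 2 ≤ Real.cos a := by
    have := Real.one_sub_sq_div_two_le_cos (x := a)
    nlinarith [sq_abs a, abs_nonneg a]
  have hcu : Real.cos u ≤ Real.cos a * Real.cos l + 1 / 4 * Real.sin l := by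
    have hu' : u = a + (u - a) := by ring
    rcases abs_choice (u - a) with h' | h'
    · rw [hu', Real.cos_add, ← h', ← hl]
      nlinarith [neg_abs_le (Real.sin a)]
    · rw [hu', show u - a = -l by rw [hl, h']; ring, ← sub_eq_add_neg, Real.cos_sub]
      nlinarith [le_abs_self (Real.sin a)]
  have hlc := mul_cos_le_sin hl0 (by linarith)
  nlinarith [mul_le_mul_of_nonneg_left hcu hl0,
    mul_le_mul_of_nonneg_right hlc (show 0 ≤ Real.cos a by linarith),
    mul_le_mul_of_nonneg_right hl2 hsin, mul_le_mul_of_nonneg_left hca hsin]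

/-- With `f` and `g` the two terms of the sine interpolation, the claim is `f² ≤ t (f + g)²`. It
follows from `f (1 - t) ≤ 2 t g`, a consequence of the preceding comparison at `t`-independent level
and of the concavity of `sin`. -/
theorem contractionCoeff_mul_cos_sq_le_sq {a u t : ℝ} (ht0 : 0 ≤ t) (ht1 : t ≤ 1)
    (ha : |a| ≤ 1 / 4) (hu : |u| ≤ Real.pi / 2) (hua : u ≠ a) :
    contractionCoeff 2 3 t |u - a| * Real.cos u ^ 2 ≤
      t * (t * Real.cos ((1 - t) * a + t * u) ^ 2) := by
  have hpi := Real.pi_gt_three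
  have h0 : 0 < |u - a| := abs_pos.2 (sub_ne_zero.2 hua)
  have hlpi : |u - a| ≤ Real.pi := (abs_sub u a).trans (by linarith)
  refine contractionCoeff_mul_le_of_sq_le ht0 h0 (by positivity) (fun _ => ?_) hlpi
  rw [mul_assoc, ← mul_pow, ← mul_pow, mul_comm (Real.cos _) (Real.sin |u - a|),
    sin_mul_cos_interpolate]
  have hcu := cos_nonneg_of_abs_le hu
  have hca : 0 ≤ Real.cos a := cos_nonneg_of_abs_le (by linarith)
  set l := |u - a|
  set f := Real.sin (t * l) * Real.cos u with hf
  set g := Real.sin ((1 - t) * l) * Real.cos a with hg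
  have hf0 : 0 ≤ f := mul_nonneg
    (Real.sin_nonneg_of_nonneg_of_le_pi (by positivity) (by nlinarith)) hcu
  have hfg : f * (1 - t) ≤ 2 * t * g := by
    have h1 : f ≤ t * l * Real.cos u :=
      mul_le_mul_of_nonneg_right (Real.sin_le (by positivity)) hcu
    have h2 : (1 - t) * Real.sin l * Real.cos a ≤ g :=
      mul_le_mul_of_nonneg_right (mul_sin_le_sin_mul h0.le hlpi (by linarith) (by linarith)) hca
    have h3 := mul_cos_le_two_mul_sin_mul_cos ha hu
    calc f * (1 - t) ≤ t * l * Real.cos u * (1 - t) :=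
        mul_le_mul_of_nonneg_right h1 (by linarith)
      _ = t * (1 - t) * (l * Real.cos u) := by ring
      _ ≤ t * (1 - t) * (2 * (Real.sin l * Real.cos a)) :=
        mul_le_mul_of_nonneg_left h3 (mul_nonneg ht0 (by linarith))
      _ = 2 * t * ((1 - t) * Real.sin l * Real.cos a) := by ring
      _ ≤ 2 * t * g := by gcongr
  nlinarith [mul_le_mul_of_nonneg_left hfg hf0, mul_nonneg ht0 (sq_nonneg g)]

/-- The mean value theorem on `[t l, l]` combined with `sin (t l) ≤ t l`. The resulting error in
`sin (t l) / sin l ≈ t` carries a factor `1 - t`, which is needed as `t → 1`. -/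
theorem sin_mul_mul_le {l t : ℝ} (h0 : 0 ≤ l) (hl : l ≤ 1) (ht0 : 0 ≤ t) (ht1 : t ≤ 1) :
    Real.sin (t * l) * (t + (1 - t) * Real.cos l) ≤ t * Real.sin l := by
  have hpi := Real.pi_gt_three
  have htl : t * l ≤ l := by nlinarith
  have h1 : Real.cos l * (l - t * l) ≤ Real.sin l - Real.sin (t * l) := by
    refine (convex_Icc 0 l).mul_sub_le_image_sub_of_le_deriv Real.continuousOn_sin
      Real.differentiable_sin.differentiableOn (fun x hx => ?_) (t * l) ⟨by positivity, htl⟩ l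
      ⟨h0, le_rfl⟩ htl
    rw [interior_Icc] at hx
    rw [Real.deriv_sin]
    exact Real.cos_le_cos_of_nonneg_of_le_pi hx.1.le (by linarith) hx.2.le
  have hcos : 0 ≤ Real.cos l := cos_nonneg_of_abs_le (by rw [abs_of_nonneg h0]; linarith)
  have h2 : Real.sin (t * l) ≤ t * l := Real.sin_le (by positivity)
  nlinarith [mul_le_mul_of_nonneg_left h1 ht0, mul_le_mul_of_nonneg_left h2
    (mul_nonneg (sub_nonneg.2 ht1) hcos)]

theorem cos_le_cos_interpolate {a u t : ℝ} (ht0 : 0 ≤ t) (ht1 : t ≤ 1)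
    (ha : |a| ≤ 1 / 4) (hu : |u| ≤ 1 / 4) (hua : |u - a| ≤ 1 / 12) :
    Real.cos u ≤ Real.cos ((1 - t) * a + t * u) * (1 + (1 - t) / 40) := by
  set x := (1 - t) * a + t * u with hx
  have hx4 : |x| ≤ 1 / 4 := abs_interpolate_le ht0 ht1 ha hu
  have hcx : 5 / 6 ≤ Real.cos x := by
    have := Real.one_sub_sq_div_two_le_cos (x := x)
    nlinarith [sq_abs x, abs_nonneg x]
  -- The constants match: `1/48 = (5/6) / 40`, with `5/6` the lower bound for `cos x`.
  have h1 : Real.cos u - Real.cos x ≤ (1 - t) / 48 := by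
    rw [Real.cos_sub_cos]
    have hs1 : |Real.sin ((u + x) / 2)| ≤ 1 / 4 := Real.abs_sin_le_abs.trans (by
      rw [abs_le] at *
      constructor <;> linarith)
    have hs2 : |Real.sin ((u - x) / 2)| ≤ (1 - t) / 24 := Real.abs_sin_le_abs.trans (by
      rw [show (u - x) / 2 = (1 - t) * (u - a) / 2 by rw [hx]; ring, abs_div, abs_mul,
        abs_of_nonneg (show 0 ≤ 1 - t by linarith), abs_two]
      nlinarith)
    calc -2 * Real.sin ((u + x) / 2) * Real.sin ((u - x) / 2)
        ≤ |-2 * Real.sin ((u + x) / 2) * Real.sin ((u - x) / 2)| := le_abs_self _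
      _ = 2 * (|Real.sin ((u + x) / 2)| * |Real.sin ((u - x) / 2)|) := by
        rw [abs_mul, abs_mul, abs_neg, abs_two, mul_assoc]
      _ ≤ 2 * (1 / 4 * ((1 - t) / 24)) := by gcongr
      _ = (1 - t) / 48 := by ring
  nlinarith

theorem contractionCoeff_mul_cos_sq_mul_le {a u t l p q : ℝ} (ht0 : 0 ≤ t) (ht1 : t ≤ 1)
    (ha : |a| ≤ 1 / 4) (hu : |u| ≤ 1 / 4) (hua : |u - a| ≤ l) (hl : l ≤ 1 / 12) (hp : 0 ≤ p)
    (hpq : p ≤ q * (1 + (1 - t) / 2)) :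
    contractionCoeff 2 3 t l * (Real.cos u ^ 2 * p) ≤
      t * (t * q * Real.cos ((1 - t) * a + t * u) ^ 2) := by
  have hpi := Real.pi_gt_three
  have hq : 0 ≤ q := by nlinarith
  have hl0 : 0 ≤ l := (abs_nonneg _).trans hua
  have htp : t * (1 + (1 - t) / 2) ≤ 1 := by nlinarith
  rcases hl0.eq_or_lt with h0 | h0
  · have hua' : u = a := by
      rw [← h0] at hua
      exact sub_eq_zero.1 (abs_nonpos_iff.1 hua)
    rw [← h0, hua', contractionCoeff_two_three, if_pos rfl,
      show (1 - t) * a + t * a = a by ring]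
    have : t * p ≤ q := by nlinarith
    nlinarith [mul_le_mul_of_nonneg_left this
      (show 0 ≤ t ^ 2 * Real.cos a ^ 2 by positivity)]
  refine contractionCoeff_mul_le_of_sq_le ht0 h0 (by positivity) (fun hsin => ?_) (by linarith)
  set x := (1 - t) * a + t * u
  have hcu : 0 ≤ Real.cos u := cos_nonneg_of_abs_le (by linarith)
  have hst : 0 ≤ Real.sin (t * l) :=
    Real.sin_nonneg_of_nonneg_of_le_pi (by positivity) (by nlinarith)
  have hc := cos_le_cos_interpolate ht0 ht1 ha hu (hua.trans hl)
  have hcl : 1 - (1 - t) / 288 ≤ t + (1 - t) * Real.cos l := by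
    have h1 := Real.one_sub_sq_div_two_le_cos (x := l)
    have h2 : 1 - 1 / 288 ≤ Real.cos l := by nlinarith
    nlinarith
  have hs : Real.sin (t * l) * (1 - (1 - t) / 288) ≤ t * Real.sin l :=
    (mul_le_mul_of_nonneg_left hcl hst).trans (sin_mul_mul_le hl0 (by linarith) ht0 ht1)
  have hsc : (Real.sin (t * l) * Real.cos u * (1 - (1 - t) / 288)) ^ 2 ≤
      (t * Real.sin l * (Real.cos x * (1 + (1 - t) / 40))) ^ 2 := by
    refine pow_le_pow_left₀ (mul_nonneg (by positivity) (by linarith)) ?_ 2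
    calc Real.sin (t * l) * Real.cos u * (1 - (1 - t) / 288)
        = Real.sin (t * l) * (1 - (1 - t) / 288) * Real.cos u := by ring
      _ ≤ _ := mul_le_mul hs hc hcu (by positivity)
  set r := 1 - t with hr
  have hr0 : 0 ≤ r := by linarith
  have hr1 : r ≤ 1 := by linarith
  -- The spare factor `t = 1 - r` turns the growth `1 + r / 2` of the height into a gain of at least
  -- `r / 2`, which dominates the errors of order `r / 20` and `r / 144` from cosine and sine.
  have hpoly : (1 + r / 40) ^ 2 * (t * (1 + r / 2)) ≤ (1 - r / 288) ^ 2 := by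
    have : t * (1 + r / 2) ≤ 1 - r / 2 := by
      rw [show t = 1 - r by rw [hr]; ring]
      nlinarith
    refine (mul_le_mul_of_nonneg_left this (sq_nonneg _)).trans ?_
    nlinarith [mul_nonneg hr0 (sub_nonneg.2 hr1), pow_nonneg hr0 3]
  refine le_of_mul_le_mul_right ?_ (show 0 < (1 - r / 288) ^ 2 by nlinarith)
  calc Real.sin (t * l) ^ 2 * (Real.cos u ^ 2 * p) * (1 - r / 288) ^ 2
      = (Real.sin (t * l) * Real.cos u * (1 - r / 288)) ^ 2 * p := by ring
    _ ≤ (t * Real.sin l * (Real.cos x * (1 + r / 40))) ^ 2 * (q * (1 + r / 2)) :=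
      mul_le_mul hsc hpq hp (sq_nonneg _)
    _ = t * q * Real.cos x ^ 2 * Real.sin l ^ 2 * ((1 + r / 40) ^ 2 * (t * (1 + r / 2))) := by
      ring
    _ ≤ t * q * Real.cos x ^ 2 * Real.sin l ^ 2 * (1 - r / 288) ^ 2 := by gcongr

/-! ### Fibre coordinates on the diamond with two segments -/

/-- Half of the length of the vertical slice of `Y` over `x`. -/
noncomputable def halfHeight (x : ℝ) : ℝ := max 0 ((1 / 4 - |x|) / 9)

theorem halfHeight_nonneg (x : ℝ) : 0 ≤ halfHeight x := le_max_left _ _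

theorem halfHeight_of_abs_le {x : ℝ} (hx : |x| ≤ 1 / 4) : halfHeight x = (1 / 4 - |x|) / 9 :=
  max_eq_right (by linarith)

theorem halfHeight_of_le_abs {x : ℝ} (hx : 1 / 4 ≤ |x|) : halfHeight x = 0 :=
  max_eq_left (by linarith)

theorem halfHeight_pos_iff {x : ℝ} : 0 < halfHeight x ↔ |x| < 1 / 4 := by
  rw [halfHeight, lt_max_iff, or_iff_right (lt_irrefl _)]
  constructor <;> intro h <;> linarith

theorem halfHeight_le (x : ℝ) : halfHeight x ≤ 1 / 36 :=
  max_le (by norm_num) (by linarith [abs_nonneg x])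

theorem abs_halfHeight_sub_le (x y : ℝ) : |halfHeight x - halfHeight y| ≤ |x - y| / 9 := by
  refine (abs_max_sub_max_le_max _ _ _ _).trans (max_le (by simp; positivity) ?_)
  rw [← sub_div, abs_div, abs_of_pos (show (0 : ℝ) < 9 by norm_num), sub_sub_sub_cancel_left,
    abs_sub_comm x y]
  exact div_le_div_of_nonneg_right (abs_abs_sub_abs_le y x) (by norm_num)

theorem continuous_halfHeight : Continuous halfHeight := by
  unfold halfHeight
  fun_prop

theorem mem_segmentBase_iff {x : ℝ} : x ∈ segmentBase ↔ 1 / 4 ≤ |x| ∧ |x| ≤ Real.pi / 2 := by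
  have hpi := Real.pi_gt_three
  simp only [segmentBase, Set.mem_union, Set.mem_Icc, le_abs, abs_le]
  constructor
  · rintro (⟨h1, h2⟩ | ⟨h1, h2⟩)
    · exact ⟨Or.inr (by linarith), by linarith, by linarith⟩
    · exact ⟨Or.inl h1, by linarith, h2⟩
  · rintro ⟨h1 | h1, h2, h3⟩
    · exact Or.inr ⟨h1, h3⟩
    · exact Or.inl ⟨h2, by linarith⟩

theorem mem_diamond_iff {x y : ℝ} : (x, y) ∈ diamond ↔ 9 * |y| ≤ 1 / 4 - |x| := Iff.rfl

theorem mem_diamond_union_segments_iff {p : ℝ × ℝ} :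
    p ∈ diamond ∪ segments ↔ |p.1| ≤ Real.pi / 2 ∧ |p.2| ≤ halfHeight p.1 := by
  have hpi := Real.pi_gt_three
  obtain ⟨x, y⟩ := p
  have hseg : (x, y) ∈ segments ↔ (1 / 4 ≤ |x| ∧ |x| ≤ Real.pi / 2) ∧ y = 0 := by
    rw [← mem_segmentBase_iff]
    exact Iff.rfl
  rw [Set.mem_union, hseg, mem_diamond_iff]
  constructor
  · rintro (h | ⟨⟨h1, h2⟩, rfl⟩)
    · have hy := abs_nonneg y
      refine ⟨by linarith, ?_⟩
      rw [halfHeight_of_abs_le (by linarith)]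
      linarith
    · exact ⟨h2, by simpa using halfHeight_nonneg x⟩
  · rintro ⟨h1, h2⟩
    change |x| ≤ _ at h1
    change |y| ≤ halfHeight x at h2
    rcases le_total |x| (1 / 4) with h | h
    · rw [halfHeight_of_abs_le h] at h2
      exact Or.inl (by linarith)
    · rw [halfHeight_of_le_abs h] at h2
      exact Or.inr ⟨⟨h, h1⟩, abs_nonpos_iff.1 h2⟩

/-- The map that scales the second coordinate to the vertical slices of `Y`. -/
noncomputable def flatten (w : ℝ × ℝ) : ℝ × ℝ := (w.1, w.2 * halfHeight w.1)

theorem continuous_flatten : Continuous flatten := by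
  have := continuous_halfHeight
  unfold flatten
  fun_prop

/-- The rectangle that is mapped onto `Y` by `flatten`. -/
def paramRect : Set (ℝ × ℝ) := Set.Icc (-(Real.pi / 2)) (Real.pi / 2) ×ˢ Set.Icc (-1) 1

theorem mem_paramRect {w : ℝ × ℝ} : w ∈ paramRect ↔ |w.1| ≤ Real.pi / 2 ∧ |w.2| ≤ 1 := by
  rw [paramRect, Set.mem_prod, Set.mem_Icc, Set.mem_Icc, ← abs_le, ← abs_le]

theorem measurableSet_paramRect : MeasurableSet paramRect :=
  measurableSet_Icc.prod measurableSet_Icc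

theorem flatten_mem {w : ℝ × ℝ} (hw : w ∈ paramRect) : flatten w ∈ diamond ∪ segments := by
  rw [mem_paramRect] at hw
  refine mem_diamond_union_segments_iff.2 ⟨hw.1, ?_⟩
  change |w.2 * halfHeight w.1| ≤ halfHeight w.1
  rw [abs_mul, abs_of_nonneg (halfHeight_nonneg _)]
  exact mul_le_of_le_one_left (halfHeight_nonneg _) hw.2

theorem exists_flatten_eq {p : ℝ × ℝ} (hp : p ∈ diamond ∪ segments) :
    ∃ w ∈ paramRect, flatten w = p := by
  rw [mem_diamond_union_segments_iff] at hp
  rcases (halfHeight_nonneg p.1).eq_or_lt with h | h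
  · refine ⟨(p.1, 0), mem_paramRect.2 ⟨hp.1, by simp⟩, Prod.ext rfl ?_⟩
    rw [← h] at hp
    simp [flatten, abs_nonpos_iff.1 hp.2]
  · refine ⟨(p.1, p.2 / halfHeight p.1), mem_paramRect.2 ⟨hp.1, ?_⟩,
      Prod.ext rfl (div_mul_cancel₀ _ h.ne')⟩
    rw [abs_div, abs_of_pos h]
    exact div_le_one_of_le₀ hp.2 h.le

/-- The parametrization of `Y` by `paramRect`. -/
noncomputable def paramSpace (w : paramRect) : DiamondSpace := ⟨flatten w, flatten_mem w.2⟩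

theorem continuous_paramSpace : Continuous paramSpace :=
  (continuous_flatten.comp continuous_subtype_val).subtype_mk _

/-! ### Geodesics in fibre coordinates -/

/-- The rate of change in `s` of the second coordinate of the path at time `t`. The case distinction
depends on `u` alone, so the map stays affine on every fibre. -/
noncomputable def fiberSlope (a t u : ℝ) : ℝ :=
  if |u - a| < 3 * halfHeight a then t * halfHeight u / halfHeight ((1 - t) * a + t * u)
  else if halfHeight a = 0 then 1 else t

/-- When `halfHeight a = 0` the quotient is `0` by convention, so together with slope `1` the fibre
coordinate is constant along the path. -/
noncomputable def fiberShift (a b t u : ℝ) : ℝ :=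
  if |u - a| < 3 * halfHeight a then (1 - t) * b / halfHeight ((1 - t) * a + t * u)
  else (1 - t) * b / halfHeight a

/-- In fibre coordinates, the point at time `t` of the geodesic from `(a, b)` to `flatten w`. For
end points that are close to `(a, b)` in comparison with the height over `a`, the geodesic is
a line segment, otherwise it is affine in fibre coordinates. -/
noncomputable def fiberPath (a b t : ℝ) (w : ℝ × ℝ) : ℝ × ℝ :=
  ((1 - t) * a + t * w.1, fiberSlope a t w.1 * w.2 + fiberShift a b t w.1)

theorem measurable_fiberSlope (a t : ℝ) : Measurable (fiberSlope a t) := by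
  have := continuous_halfHeight.measurable
  refine Measurable.ite (measurableSet_lt (by fun_prop) measurable_const) ?_ measurable_const
  fun_prop

theorem measurable_fiberShift (a b t : ℝ) : Measurable (fiberShift a b t) := by
  have := continuous_halfHeight.measurable
  refine Measurable.ite (measurableSet_lt (by fun_prop) measurable_const) ?_ measurable_const
  fun_prop

theorem measurable_fiberPath (a b t : ℝ) : Measurable (fiberPath a b t) := by
  have h1 := measurable_fiberSlope a t
  have h2 := measurable_fiberShift a b t
  unfold fiberPath
  fun_prop

section Near

variable {a u : ℝ} (h : |u - a| < 3 * halfHeight a)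

include h

theorem abs_lt_of_near : |a| < 1 / 4 :=
  halfHeight_pos_iff.1 (by linarith [abs_nonneg (u - a)])

theorem abs_lt_of_near' : |u| < 1 / 4 := by
  have h' := abs_lt_of_near h
  rw [halfHeight_of_abs_le h'.le] at h
  have := abs_sub_abs_le_abs_sub u a
  linarith

/-- The half height is concave over the diamond, though not on the whole line; nearness keeps both
ends over the diamond. -/
theorem le_halfHeight_interpolate {t : ℝ} (ht0 : 0 ≤ t) (ht1 : t ≤ 1) :
    (1 - t) * halfHeight a + t * halfHeight u ≤ halfHeight ((1 - t) * a + t * u) := by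
  have ha := (abs_lt_of_near h).le
  have hu := (abs_lt_of_near' h).le
  rw [halfHeight_of_abs_le ha, halfHeight_of_abs_le hu,
    halfHeight_of_abs_le (abs_interpolate_le ht0 ht1 ha hu)]
  have : |(1 - t) * a + t * u| ≤ (1 - t) * |a| + t * |u| := by
    refine (abs_add_le _ _).trans_eq ?_
    rw [abs_mul, abs_mul, abs_of_nonneg ht0, abs_of_nonneg (sub_nonneg.2 ht1)]
  linarith

theorem halfHeight_interpolate_pos {t : ℝ} (ht0 : 0 ≤ t) (ht1 : t ≤ 1) :
    0 < halfHeight ((1 - t) * a + t * u) := by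
  have ha := halfHeight_pos_iff.2 (abs_lt_of_near h)
  have hu := halfHeight_pos_iff.2 (abs_lt_of_near' h)
  have := le_halfHeight_interpolate h ht0 ht1
  rcases ht0.eq_or_lt with rfl | ht
  · linarith
  · nlinarith [mul_pos ht hu]

theorem halfHeight_interpolate_le {t : ℝ} (ht1 : t ≤ 1) :
    halfHeight ((1 - t) * a + t * u) ≤ halfHeight u * (1 + (1 - t) / 2) := by
  have h1 := (le_abs_self _).trans (abs_halfHeight_sub_le ((1 - t) * a + t * u) u)
  have h2 := (le_abs_self _).trans (abs_halfHeight_sub_le a u)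
  rw [show (1 - t) * a + t * u - u = (1 - t) * (a - u) by ring, abs_mul,
    abs_of_nonneg (sub_nonneg.2 ht1)] at h1
  rw [abs_sub_comm] at h
  -- From `|u - a| < 3 h(a) ≤ 3 h(u) + |u - a| / 3`.
  have h3 : |a - u| / 9 ≤ halfHeight u / 2 := by linarith
  nlinarith [mul_le_mul_of_nonneg_left h3 (sub_nonneg.2 ht1)]

theorem flatten_fiberPath_of_near (b : ℝ) {t : ℝ} (ht0 : 0 ≤ t) (ht1 : t ≤ 1) (s : ℝ) :
    flatten (fiberPath a b t (u, s)) =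
      ((1 - t) * a + t * u, (1 - t) * b + t * (s * halfHeight u)) := by
  have := (halfHeight_interpolate_pos h ht0 ht1).ne'
  simp only [flatten, fiberPath, fiberSlope, fiberShift, if_pos h]
  congr 1
  field_simp
  ring

end Near

section

variable {a b : ℝ} (hb : |b| ≤ halfHeight a)

include hb

theorem abs_div_halfHeight_le_one : |b / halfHeight a| ≤ 1 := by
  rw [abs_div, abs_of_nonneg (halfHeight_nonneg a)]
  exact div_le_one_of_le₀ hb (halfHeight_nonneg a)

theorem abs_fiberPath_snd_le {t : ℝ} (ht0 : 0 ≤ t) (ht1 : t ≤ 1) {w : ℝ × ℝ}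
    (hw : |w.2| ≤ 1) : |(fiberPath a b t w).2| ≤ 1 := by
  obtain ⟨u, s⟩ := w
  change |s| ≤ 1 at hw
  simp only [fiberPath, fiberSlope, fiberShift]
  split_ifs with h h'
  · have hx := halfHeight_interpolate_pos h ht0 ht1
    rw [div_mul_eq_mul_div, ← add_div, abs_div, abs_of_pos hx]
    refine div_le_one_of_le₀ ?_ hx.le
    refine le_trans ?_ (le_halfHeight_interpolate h ht0 ht1)
    refine (abs_add_le _ _).trans ?_
    rw [abs_mul, abs_mul, abs_mul, abs_of_nonneg ht0, abs_of_nonneg (sub_nonneg.2 ht1),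
      abs_of_nonneg (halfHeight_nonneg u), add_comm]
    refine add_le_add (mul_le_mul_of_nonneg_left hb (sub_nonneg.2 ht1)) ?_
    exact mul_le_of_le_one_right (mul_nonneg ht0 (halfHeight_nonneg u)) hw
  · simpa [h'] using hw
  · rw [mul_div_assoc, add_comm]
    exact abs_interpolate_le ht0 ht1 (abs_div_halfHeight_le_one hb) hw

theorem fiberPath_mem (ha : |a| ≤ Real.pi / 2) {t : ℝ} (ht0 : 0 ≤ t) (ht1 : t ≤ 1) {w : ℝ × ℝ}
    (hw : w ∈ paramRect) : fiberPath a b t w ∈ paramRect := by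
  rw [mem_paramRect] at *
  exact ⟨abs_interpolate_le ht0 ht1 ha hw.1, abs_fiberPath_snd_le hb ht0 ht1 hw.2⟩

theorem flatten_fiberPath_zero (w : ℝ × ℝ) : flatten (fiberPath a b 0 w) = (a, b) := by
  simp only [flatten, fiberPath, fiberSlope, fiberShift, sub_zero, one_mul, zero_mul, add_zero,
    zero_div, ite_self]
  refine Prod.ext rfl ?_
  rcases (halfHeight_nonneg a).eq_or_lt with h | h
  · rw [← h] at hb
    simp [← h, abs_nonpos_iff.1 hb]
  · simp [h.ne']

omit hb in
theorem fiberPath_one (w : ℝ × ℝ) : fiberPath a b 1 w = w := by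
  simp only [fiberPath, fiberSlope, fiberShift, sub_self, zero_mul, one_mul, zero_add, zero_div,
    ite_self, add_zero]
  refine Prod.ext rfl ?_
  split_ifs with h
  · simp [(halfHeight_pos_iff.2 (abs_lt_of_near' h)).ne']
  · simp

theorem abs_flatten_fiberPath_snd_sub_le {t t' : ℝ} (ht0 : 0 ≤ t) (ht1 : t ≤ 1)
    (ht0' : 0 ≤ t') (ht1' : t' ≤ 1) {w : ℝ × ℝ} (hw : |w.2| ≤ 1)
    (h : ¬|w.1 - a| < 3 * halfHeight a) :
    |(flatten (fiberPath a b t w)).2 - (flatten (fiberPath a b t' w)).2| ≤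
      |t' - t| * |w.1 - a| := by
  have hs := abs_fiberPath_snd_le hb ht0 ht1 hw
  obtain ⟨u, s⟩ := w
  set σ := (fiberPath a b t (u, s)).2 with hσ
  set σ' := (fiberPath a b t' (u, s)).2 with hσ'
  set x := (1 - t) * a + t * u with hx
  set x' := (1 - t') * a + t' * u with hx'
  change |σ * halfHeight x - σ' * halfHeight x'| ≤ |t' - t| * |u - a|
  change |s| ≤ 1 at hw
  change ¬|u - a| < _ at h
  rw [not_lt] at h
  have hlip : |halfHeight x - halfHeight x'| ≤ |t' - t| * |u - a| / 9 := by
    refine (abs_halfHeight_sub_le _ _).trans_eq ?_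
    rw [← abs_mul, ← abs_neg, hx, hx']
    congr 2
    ring
  have hx'h : halfHeight x' ≤ halfHeight a + |u - a| / 9 := by
    have h1 := (le_abs_self _).trans (abs_halfHeight_sub_le x' a)
    rw [hx', show (1 - t') * a + t' * u - a = t' * (u - a) by ring, abs_mul,
      abs_of_nonneg ht0'] at h1
    nlinarith [abs_nonneg (u - a)]
  have hσσ : |σ - σ'| * halfHeight x' ≤ |t' - t| * (2 * (halfHeight a + |u - a| / 9)) := by
    simp only [hσ, hσ', fiberPath, fiberSlope, fiberShift, if_neg (not_lt.2 h)]
    split_ifs with h'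
    · simp only [h', div_zero, sub_self, abs_zero, zero_mul]
      positivity
    · have : |t * s + (1 - t) * b / halfHeight a - (t' * s + (1 - t') * b / halfHeight a)| ≤
          |t' - t| * 2 := by
        rw [show t * s + (1 - t) * b / halfHeight a - (t' * s + (1 - t') * b / halfHeight a) =
          (t' - t) * (b / halfHeight a - s) by ring, abs_mul]
        gcongr
        refine (abs_sub _ _).trans ?_
        linarith [abs_div_halfHeight_le_one hb]
      calc _ ≤ |t' - t| * 2 * (halfHeight a + |u - a| / 9) :=
            mul_le_mul this hx'h (halfHeight_nonneg _) (by positivity)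
        _ = _ := by ring
  -- A discrete product rule. The threshold `3` is chosen for the last step: `|u - a| / 3 + 2 h(a) ≤
  -- |u - a|` means exactly `3 h(a) ≤ |u - a|`.
  calc |σ * halfHeight x - σ' * halfHeight x'|
      = |σ * (halfHeight x - halfHeight x') + (σ - σ') * halfHeight x'| := by ring_nf
    _ ≤ |σ| * |halfHeight x - halfHeight x'| + |σ - σ'| * halfHeight x' := by
      refine (abs_add_le _ _).trans_eq ?_
      rw [abs_mul, abs_mul, abs_of_nonneg (halfHeight_nonneg x')]
    _ ≤ 1 * (|t' - t| * |u - a| / 9) + |t' - t| * (2 * (halfHeight a + |u - a| / 9)) := by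
      gcongr
    _ = |t' - t| * (|u - a| / 3 + 2 * halfHeight a) := by ring
    _ ≤ |t' - t| * |u - a| := by
      gcongr
      linarith

omit hb in
theorem dist_flatten_fiberPath_fst (t t' : ℝ) (w : ℝ × ℝ) :
    dist (flatten (fiberPath a b t w)).1 (flatten (fiberPath a b t' w)).1 =
      |t' - t| * |w.1 - a| := by
  rw [Real.dist_eq, ← abs_mul, ← abs_neg]
  congr 1
  simp only [flatten, fiberPath]
  ring

theorem dist_eq_of_not_near {w : ℝ × ℝ} (hw : |w.2| ≤ 1)
    (h : ¬|w.1 - a| < 3 * halfHeight a) : dist (a, b) (flatten w) = |w.1 - a| := by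
  have h1 := abs_flatten_fiberPath_snd_sub_le hb le_rfl zero_le_one zero_le_one le_rfl hw h
  rw [flatten_fiberPath_zero hb, fiberPath_one, sub_zero, abs_one, one_mul] at h1
  rw [Prod.dist_eq, Real.dist_eq, Real.dist_eq, max_eq_left]
  · exact abs_sub_comm _ _
  · exact h1.trans_eq (abs_sub_comm _ _)

theorem dist_flatten_fiberPath {t t' : ℝ} (ht0 : 0 ≤ t) (ht1 : t ≤ 1)
    (ht0' : 0 ≤ t') (ht1' : t' ≤ 1) {w : ℝ × ℝ} (hw : |w.2| ≤ 1) :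
    dist (flatten (fiberPath a b t w)) (flatten (fiberPath a b t' w)) =
      |t' - t| * dist (a, b) (flatten w) := by
  by_cases h : |w.1 - a| < 3 * halfHeight a
  · obtain ⟨u, s⟩ := w
    rw [flatten_fiberPath_of_near h b ht0 ht1, flatten_fiberPath_of_near h b ht0' ht1',
      Prod.dist_eq, Prod.dist_eq, mul_max_of_nonneg _ _ (abs_nonneg _)]
    simp only [Real.dist_eq, ← abs_mul, flatten]
    congr 2 <;> ring
  · rw [dist_eq_of_not_near hb hw h, Prod.dist_eq, dist_flatten_fiberPath_fst]
    exact max_eq_left (abs_flatten_fiberPath_snd_sub_le hb ht0 ht1 ht0' ht1' hw h)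

/-- The contraction estimate along `fiberPath`, in fibre coordinates. -/
theorem contractionCoeff_mul_cos_sq_le_fiberSlope (ha : |a| ≤ Real.pi / 2) {t : ℝ} (ht0 : 0 ≤ t)
    (ht1 : t ≤ 1) {w : ℝ × ℝ} (hw : w ∈ paramRect) :
    contractionCoeff 2 3 t (dist (a, b) (flatten w)) * Real.cos w.1 ^ 2 ≤
      t * (fiberSlope a t w.1 * Real.cos ((1 - t) * a + t * w.1) ^ 2) := by
  rw [mem_paramRect] at hw
  by_cases h : |w.1 - a| < 3 * halfHeight a
  · have hx := halfHeight_interpolate_pos h ht0 ht1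
    have ha4 := (abs_lt_of_near h).le
    have hu4 := (abs_lt_of_near' h).le
    -- Horizontally `3 h(a) ≤ 3/36`, vertically at most `2/36`.
    have hl : dist (a, b) (flatten w) ≤ 1 / 12 := by
      rw [Prod.dist_eq, dist_comm a, Real.dist_eq, Real.dist_eq]
      have hmem := (mem_diamond_union_segments_iff.1 (flatten_mem (mem_paramRect.2 hw))).2
      have ha36 := halfHeight_le a
      refine max_le ?_ ?_
      · exact h.le.trans (by linarith)
      · refine (abs_sub _ _).trans ?_
        linarith [halfHeight_le (flatten w).1]
    have hua : |w.1 - a| ≤ dist (a, b) (flatten w) := by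
      rw [Prod.dist_eq, dist_comm a, Real.dist_eq]
      exact le_max_left _ _
    have key := contractionCoeff_mul_cos_sq_mul_le ht0 ht1 ha4 hu4 hua hl hx.le
      (halfHeight_interpolate_le h ht1)
    rw [fiberSlope, if_pos h]
    refine le_of_mul_le_mul_right ?_ hx
    rw [mul_assoc]
    refine key.trans_eq ?_
    field_simp
  · rw [dist_eq_of_not_near hb hw.2 h, fiberSlope, if_neg h]
    split_ifs with h'
    · rw [one_mul]
      exact contractionCoeff_mul_cos_sq_le ht0 ht1 ha hw.1
    · have h0 := (halfHeight_nonneg a).lt_of_ne' h'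
      refine contractionCoeff_mul_cos_sq_le_sq ht0 ht1 (halfHeight_pos_iff.1 h0).le hw.1 ?_
      intro hua
      rw [hua, sub_self, abs_zero] at h
      linarith

end

theorem fiberSlope_pos {a t u : ℝ} (ht0 : 0 < t) (ht1 : t ≤ 1) : 0 < fiberSlope a t u := by
  unfold fiberSlope
  split_ifs with h
  · exact div_pos (mul_pos ht0 (halfHeight_pos_iff.2 (abs_lt_of_near' h)))
      (halfHeight_interpolate_pos h ht0.le ht1)
  · exact one_pos
  · exact ht0

/-! ### The measure in fibre coordinates -/

/-- The density of `cos² x dx ds / 2`. -/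
noncomputable def paramDensity (w : ℝ × ℝ) : ENNReal := ENNReal.ofReal (Real.cos w.1 ^ 2 / 2)

theorem measurable_paramDensity : Measurable paramDensity := by
  unfold paramDensity
  fun_prop

/-- The measure `cos² x dx ds / 2` on the rectangle of fibre coordinates. -/
noncomputable def paramMeasure : Measure paramRect :=
  ((volume : Measure (ℝ × ℝ)).withDensity paramDensity).comap Subtype.val

theorem setLIntegral_withDensity_paramDensity {F : ℝ × ℝ → ENNReal} (hF : Measurable F) :
    ∫⁻ w in paramRect, F w ∂((volume : Measure (ℝ × ℝ)).withDensity paramDensity) =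
      ∫⁻ w, paramRect.indicator (fun w => paramDensity w * F w) w := by
  rw [setLIntegral_withDensity_eq_setLIntegral_mul _ measurable_paramDensity hF
    measurableSet_paramRect, lintegral_indicator measurableSet_paramRect]
  rfl

theorem lintegral_paramMeasure {F : ℝ × ℝ → ENNReal} (hF : Measurable F) :
    ∫⁻ w : paramRect, F w ∂paramMeasure =
      ∫⁻ w, paramRect.indicator (fun w => paramDensity w * F w) w := by
  rw [paramMeasure, lintegral_subtype_comap measurableSet_paramRect,
    setLIntegral_withDensity_paramDensity hF]

theorem measurable_indicator_paramDensity_mul {F : ℝ × ℝ → ENNReal} (hF : Measurable F) :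
    Measurable (paramRect.indicator fun w => paramDensity w * F w) :=
  (measurable_paramDensity.mul hF).indicator measurableSet_paramRect

theorem lintegral_comp_mul_add {f : ℝ → ENNReal} (hf : Measurable f) {c : ℝ} (hc : 0 < c)
    (d : ℝ) : ∫⁻ s, ENNReal.ofReal c * f (c * s + d) = ∫⁻ s, f s := by
  have hfd : Measurable fun s => f (s + d) := by fun_prop
  have h1 : ∫⁻ s, f (c * s + d) = ENNReal.ofReal c⁻¹ * ∫⁻ s, f s := by
    rw [← lintegral_map (μ := volume) (g := fun s => c * s) hfd (by fun_prop),
      Real.map_volume_mul_left hc.ne', lintegral_smul_measure,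
      lintegral_add_right_eq_self f d, abs_of_pos (inv_pos.2 hc), smul_eq_mul]
  rw [lintegral_const_mul _ (by fun_prop), h1, ← mul_assoc, ← ENNReal.ofReal_mul hc.le,
    mul_inv_cancel₀ hc.ne', ENNReal.ofReal_one, one_mul]

theorem lintegral_indicator_paramRect {F : ℝ → ENNReal} (x : ℝ) :
    ∫⁻ s, paramRect.indicator (fun w => paramDensity w * F w.1) (x, s) =
      (Set.Icc (-(Real.pi / 2)) (Real.pi / 2)).indicator
        (fun x => ENNReal.ofReal (Real.cos x ^ 2) * F x) x := by
  by_cases hx : x ∈ Set.Icc (-(Real.pi / 2)) (Real.pi / 2)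
  · have : (fun s => paramRect.indicator (fun w => paramDensity w * F w.1) (x, s)) =
        (Set.Icc (-1 : ℝ) 1).indicator
          fun _ => ENNReal.ofReal (Real.cos x ^ 2 / 2) * F x := by
      ext s
      simp only [Set.indicator, paramRect, Set.mem_prod, hx, true_and]
      rfl
    rw [this, lintegral_indicator_const measurableSet_Icc, Real.volume_Icc,
      Set.indicator_of_mem hx, mul_right_comm, ← ENNReal.ofReal_mul (by positivity)]
    norm_num
  · rw [Set.indicator_of_notMem hx]
    refine (lintegral_congr fun s => Set.indicator_of_notMem ?_ _).trans lintegral_zero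
    exact fun h => hx h.1

theorem measurableSet_diamond : MeasurableSet diamond :=
  measurableSet_le (by fun_prop) (by fun_prop)

theorem measurableSet_segmentBase : MeasurableSet segmentBase :=
  measurableSet_Icc.union measurableSet_Icc

theorem isClosed_diamond_union_segments : IsClosed (diamond ∪ segments) := by
  refine IsClosed.union (isClosed_le (by fun_prop) (by fun_prop)) ?_
  exact (isClosed_Icc.union isClosed_Icc).prod isClosed_singleton

theorem measurable_indicator_diamond {F : ℝ × ℝ → ENNReal} (hF : Measurable F) :
    Measurable (diamond.indicator
      fun p => ENNReal.ofReal (Real.cos p.1 ^ 2 / sliceLength p.1) * F p) := by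
  refine Measurable.indicator ?_ measurableSet_diamond
  unfold sliceLength
  fun_prop

/-- Slice by slice: over `|x| < 1/4` substitute `y = h(x) s`; over `|x| ≥ 1/4` the fibre collapses
to one point, which receives its whole mass `cos² x`. -/
theorem lintegral_indicator_comp_flatten {F : ℝ × ℝ → ENNReal} (hF : Measurable F) (x : ℝ) :
    ∫⁻ s, paramRect.indicator (fun w => paramDensity w * F (flatten w)) (x, s) =
      (∫⁻ y, diamond.indicator
        (fun p => ENNReal.ofReal (Real.cos p.1 ^ 2 / sliceLength p.1) * F p) (x, y)) +
      segmentBase.indicator (fun x => ENNReal.ofReal (Real.cos x ^ 2) * F (x, 0)) x := by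
  have hpi := Real.pi_gt_three
  rcases lt_or_ge |x| (1 / 4) with hx | hx
  · have hh := halfHeight_pos_iff.2 hx
    have hsl : sliceLength x = 2 * halfHeight x := by
      rw [halfHeight_of_abs_le hx.le, sliceLength]
      ring
    rw [Set.indicator_of_notMem fun h => (mem_segmentBase_iff.1 h).1.not_gt hx, add_zero]
    refine (lintegral_congr fun s => ?_).trans (lintegral_comp_mul_add
      ((measurable_indicator_diamond hF).comp measurable_prodMk_left) hh 0)
    rw [add_zero, Function.comp_apply]
    have hiff : (x, s) ∈ paramRect ↔ (x, halfHeight x * s) ∈ diamond := by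
      rw [mem_paramRect, mem_diamond_iff, abs_mul, abs_of_pos hh,
        and_iff_right (show |x| ≤ Real.pi / 2 by linarith)]
      have : 1 / 4 - |x| = 9 * halfHeight x := by
        rw [halfHeight_of_abs_le hx.le]
        ring
      rw [this]
      change |s| ≤ 1 ↔ _
      constructor <;> intro h <;> nlinarith
    by_cases hs : (x, s) ∈ paramRect
    · rw [Set.indicator_of_mem hs, Set.indicator_of_mem (hiff.1 hs), ← mul_assoc,
        ← ENNReal.ofReal_mul hh.le, paramDensity, flatten, mul_comm s]
      congr 2
      change _ = halfHeight x * (Real.cos x ^ 2 / sliceLength x)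
      rw [hsl]
      field_simp
    · rw [Set.indicator_of_notMem hs, Set.indicator_of_notMem (fun h => hs (hiff.2 h)), mul_zero]
  · have hh := halfHeight_of_le_abs hx
    have h1 : ∀ y, diamond.indicator
        (fun p => ENNReal.ofReal (Real.cos p.1 ^ 2 / sliceLength p.1) * F p) (x, y) = 0 := by
      intro y
      -- At the tips `|x| = 1/4` the slice length is `0`, so the density is `0` there by the
      -- convention on division.
      have : Real.cos x ^ 2 / sliceLength x ≤ 0 :=
        div_nonpos_of_nonneg_of_nonpos (sq_nonneg _) (by unfold sliceLength; linarith)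
      refine Set.indicator_apply_eq_zero.2 fun _ => ?_
      rw [ENNReal.ofReal_of_nonpos this, zero_mul]
    have h2 : (fun s => paramRect.indicator (fun w => paramDensity w * F (flatten w)) (x, s)) =
        fun s => paramRect.indicator (fun w => paramDensity w * F (w.1, 0)) (x, s) := by
      ext s
      simp [Set.indicator, flatten, hh]
    rw [lintegral_congr h1, lintegral_zero, zero_add, h2,
      lintegral_indicator_paramRect (F := fun x => F (x, 0))]
    have : x ∈ Set.Icc (-(Real.pi / 2)) (Real.pi / 2) ↔ x ∈ segmentBase := by
      rw [mem_segmentBase_iff, Set.mem_Icc, ← abs_le, and_iff_right hx]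
    by_cases h : x ∈ segmentBase
    · rw [Set.indicator_of_mem h, Set.indicator_of_mem (this.2 h)]
    · rw [Set.indicator_of_notMem h, Set.indicator_of_notMem (mt this.1 h)]

theorem planeMeasure_eq_map :
    planeMeasure =
      (((volume : Measure (ℝ × ℝ)).withDensity paramDensity).restrict paramRect).map flatten := by
  ext S hS
  have hfl := continuous_flatten.measurable
  have hF : Measurable (S.indicator (1 : ℝ × ℝ → ENNReal)) := measurable_one.indicator hS
  have hr : (((volume : Measure (ℝ × ℝ)).withDensity paramDensity).restrict paramRect).map
      flatten S = ∫⁻ x, ∫⁻ s, paramRect.indicator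
        (fun w => paramDensity w * S.indicator 1 (flatten w)) (x, s) := by
    rw [← lintegral_indicator_one hS, lintegral_map hF hfl]
    exact (setLIntegral_withDensity_paramDensity (hF.comp hfl)).trans
      (lintegral_prod _ (measurable_indicator_paramDensity_mul (hF.comp hfl)).aemeasurable)
  have hd : Measurable fun p : ℝ × ℝ => ENNReal.ofReal (Real.cos p.1 ^ 2 / sliceLength p.1) := by
    unfold sliceLength
    fun_prop
  have hl1 : ((volume : Measure (ℝ × ℝ)).restrict diamond).withDensity
      (fun p => ENNReal.ofReal (Real.cos p.1 ^ 2 / sliceLength p.1)) S =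
      ∫⁻ x, ∫⁻ y, diamond.indicator (fun p =>
        ENNReal.ofReal (Real.cos p.1 ^ 2 / sliceLength p.1) * S.indicator 1 p) (x, y) := by
    rw [← lintegral_indicator_one hS, lintegral_withDensity_eq_lintegral_mul _ hd hF,
      ← lintegral_indicator measurableSet_diamond]
    exact lintegral_prod _ (measurable_indicator_diamond hF).aemeasurable
  have hl2 : (((volume : Measure ℝ).restrict segmentBase).withDensity
      (fun x => ENNReal.ofReal (Real.cos x ^ 2))).map (fun x => (x, (0 : ℝ))) S =
      ∫⁻ x, segmentBase.indicator
        (fun x => ENNReal.ofReal (Real.cos x ^ 2) * S.indicator 1 (x, 0)) x := by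
    have hi : Measurable fun x : ℝ => (x, (0 : ℝ)) := by fun_prop
    rw [← lintegral_indicator_one hS, lintegral_map hF hi,
      lintegral_indicator measurableSet_segmentBase]
    exact lintegral_withDensity_eq_lintegral_mul _ (by fun_prop) (hF.comp hi)
  rw [hr, planeMeasure, Measure.add_apply, hl1, hl2,
    ← lintegral_add_left (measurable_indicator_diamond hF).lintegral_prod_right']
  exact lintegral_congr fun x => (lintegral_indicator_comp_flatten hF x).symm

theorem diamondMeasure_eq_map : diamondMeasure = paramMeasure.map paramSpace := by
  have hY := isClosed_diamond_union_segments.measurableSet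
  ext B hB
  have hB' : MeasurableSet (Subtype.val '' B : Set (ℝ × ℝ)) := hY.subtype_image hB
  rw [diamondMeasure, comap_subtype_coe_apply hY, planeMeasure_eq_map,
    Measure.map_apply continuous_flatten.measurable hB',
    Measure.restrict_apply (continuous_flatten.measurable hB'),
    Measure.map_apply continuous_paramSpace.measurable hB, paramMeasure,
    comap_subtype_coe_apply measurableSet_paramRect]
  congr 1
  ext w
  constructor
  · rintro ⟨⟨p, hp, hpw⟩, hw⟩
    refine ⟨⟨w, hw⟩, ?_, rfl⟩
    have : paramSpace ⟨w, hw⟩ = p := Subtype.ext hpw.symm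
    rwa [Set.mem_preimage, this]
  · rintro ⟨v, hv, rfl⟩
    exact ⟨⟨_, hv, rfl⟩, v.2⟩

theorem diamondMeasure_map_fst :
    diamondMeasure.map (fun p : DiamondSpace => p.1.1) =
      ((volume : Measure ℝ).restrict (Set.Icc (-(Real.pi / 2)) (Real.pi / 2))).withDensity
        (fun x => ENNReal.ofReal (Real.cos x ^ 2)) := by
  rw [diamondMeasure_eq_map, Measure.map_map (by fun_prop) continuous_paramSpace.measurable]
  ext S hS
  have hF : Measurable (S.indicator (1 : ℝ → ENNReal)) := measurable_one.indicator hS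
  have hF' : Measurable fun w : ℝ × ℝ => S.indicator (1 : ℝ → ENNReal) w.1 :=
    hF.comp measurable_fst
  have h1 : ∫⁻ w, S.indicator 1 (((fun p : DiamondSpace => p.1.1) ∘ paramSpace) w) ∂paramMeasure =
      ∫⁻ x, ∫⁻ s, paramRect.indicator
        (fun w => paramDensity w * S.indicator 1 w.1) (x, s) :=
    (lintegral_paramMeasure hF').trans
      (lintegral_prod _ (measurable_indicator_paramDensity_mul hF').aemeasurable)
  rw [← lintegral_indicator_one hS, lintegral_map hF
    ((by fun_prop : Measurable fun p : DiamondSpace => p.1.1).comp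
      continuous_paramSpace.measurable), h1, ← lintegral_indicator_one hS,
    lintegral_withDensity_eq_lintegral_mul _ (by fun_prop) hF,
    ← lintegral_indicator measurableSet_Icc]
  exact lintegral_congr fun x => lintegral_indicator_paramRect x

instance : IsFiniteMeasure diamondMeasure := by
  constructor
  have h : diamondMeasure.map (fun p : DiamondSpace => p.1.1) Set.univ < ⊤ := by
    rw [diamondMeasure_map_fst, withDensity_apply _ MeasurableSet.univ, Measure.restrict_univ]
    calc _ ≤ ∫⁻ x in Set.Icc (-(Real.pi / 2)) (Real.pi / 2), 1 := by
          refine lintegral_mono fun x => ?_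
          exact ENNReal.ofReal_le_one.2 (Real.cos_sq_le_one x)
      _ < ⊤ := by simp
  rwa [Measure.map_apply (by fun_prop) MeasurableSet.univ] at h

/-! ### Contraction of the measure -/

/-- The map is triangular: affine of slope `t` in `u` and, for fixed `u`, affine of slope
`fiberSlope` in `s`. Tonelli and two affine substitutions suffice, so the jump of the path between
near and far end points is harmless. -/
theorem lintegral_comp_fiberPath {F : ℝ × ℝ → ENNReal} (hF : Measurable F) (a b : ℝ) {t : ℝ}
    (ht0 : 0 < t) (ht1 : t ≤ 1) :
    ∫⁻ w, ENNReal.ofReal (t * fiberSlope a t w.1) * F (fiberPath a b t w) = ∫⁻ w, F w := by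
  have hsl := measurable_fiberSlope a t
  have hm : Measurable fun w : ℝ × ℝ =>
      ENNReal.ofReal (t * fiberSlope a t w.1) * F (fiberPath a b t w) := by
    have := hF.comp (measurable_fiberPath a b t)
    refine Measurable.mul ?_ this
    fun_prop
  have hG : Measurable fun x => ∫⁻ s, F (x, s) := hF.lintegral_prod_right'
  rw [Measure.volume_eq_prod, lintegral_prod _ hm.aemeasurable, lintegral_prod _ hF.aemeasurable,
    ← lintegral_comp_mul_add hG ht0 ((1 - t) * a)]
  refine lintegral_congr fun u => ?_
  have hpos := fiberSlope_pos (a := a) (u := u) ht0 ht1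
  have h := lintegral_comp_mul_add (f := fun s => F ((1 - t) * a + t * u, s))
    (hF.comp measurable_prodMk_left) hpos (fiberShift a b t u)
  have hFu : Measurable fun s => F (fiberPath a b t (u, s)) :=
    hF.comp ((measurable_fiberPath a b t).comp measurable_prodMk_left)
  rw [add_comm (t * u), ← h]
  refine Eq.trans (lintegral_congr fun s => ?_) (lintegral_const_mul _ (hFu.const_mul _))
  rw [ENNReal.ofReal_mul ht0.le, mul_assoc]
  rfl

theorem setLIntegral_contractionCoeff_le {a b : ℝ} (hb : |b| ≤ halfHeight a)
    (ha : |a| ≤ Real.pi / 2) {t : ℝ} (ht0 : 0 ≤ t) (ht1 : t ≤ 1) {S : Set (ℝ × ℝ)}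
    (hS : MeasurableSet S) :
    ∫⁻ w in {w : paramRect | fiberPath a b t w ∈ S},
        ENNReal.ofReal (contractionCoeff 2 3 t (dist (a, b) (flatten w))) ∂paramMeasure ≤
      paramMeasure (Subtype.val ⁻¹' S) := by
  rcases ht0.eq_or_lt with rfl | ht
  -- At `t = 0` everything collapses to the starting point and the Jacobian vanishes, but so does
  -- the coefficient.
  · have : ∀ d, contractionCoeff 2 3 0 d = 0 := fun d => by
      rw [contractionCoeff_two_three]
      split_ifs <;> simp
    simp [this]
  have hfp := measurable_fiberPath a b t
  have hco : Measurable fun w : ℝ × ℝ =>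
      ENNReal.ofReal (contractionCoeff 2 3 t (dist (a, b) (flatten w))) :=
    ((measurable_contractionCoeff 2 3 t).comp
      (continuous_const.dist continuous_flatten).measurable).ennreal_ofReal
  have hF : Measurable ((fiberPath a b t ⁻¹' S).indicator fun w : ℝ × ℝ =>
      ENNReal.ofReal (contractionCoeff 2 3 t (dist (a, b) (flatten w)))) :=
    hco.indicator (hfp hS)
  have hS1 : Measurable (S.indicator (1 : ℝ × ℝ → ENNReal)) := measurable_one.indicator hS
  have hSp : MeasurableSet {w : paramRect | fiberPath a b t w ∈ S} :=
    (hfp.comp measurable_subtype_coe) hS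
  have hl : ∫⁻ w in {w : paramRect | fiberPath a b t w ∈ S},
      ENNReal.ofReal (contractionCoeff 2 3 t (dist (a, b) (flatten w))) ∂paramMeasure =
      ∫⁻ w, paramRect.indicator (fun w => paramDensity w *
        (fiberPath a b t ⁻¹' S).indicator (fun w : ℝ × ℝ =>
          ENNReal.ofReal (contractionCoeff 2 3 t (dist (a, b) (flatten w)))) w) w := by
    rw [← lintegral_indicator hSp, ← lintegral_paramMeasure hF]
    rfl
  have hr : paramMeasure (Subtype.val ⁻¹' S) =
      ∫⁻ w, paramRect.indicator (fun w => paramDensity w * S.indicator 1 w) w := by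
    rw [← lintegral_paramMeasure hS1, ← lintegral_indicator_one (measurable_subtype_coe hS)]
    rfl
  rw [hl, hr, ← lintegral_comp_fiberPath (measurable_indicator_paramDensity_mul hS1) a b ht ht1]
  refine lintegral_mono fun w => ?_
  by_cases hw : w ∈ paramRect
  · rw [Set.indicator_of_mem hw, Set.indicator_of_mem (fiberPath_mem hb ha ht0 ht1 hw)]
    by_cases hwS : fiberPath a b t w ∈ S
    · rw [Set.indicator_of_mem (show w ∈ fiberPath a b t ⁻¹' S from hwS),
        Set.indicator_of_mem hwS, Pi.one_apply, mul_one, paramDensity, paramDensity,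
        ← ENNReal.ofReal_mul (by positivity),
        ← ENNReal.ofReal_mul (mul_nonneg ht0 (fiberSlope_pos ht ht1).le)]
      refine ENNReal.ofReal_le_ofReal ?_
      have := contractionCoeff_mul_cos_sq_le_fiberSlope hb ha ht0 ht1 hw
      change _ ≤ t * fiberSlope a t w.1 * (Real.cos ((1 - t) * a + t * w.1) ^ 2 / 2)
      linarith
    · rw [Set.indicator_of_notMem (show w ∉ fiberPath a b t ⁻¹' S from hwS), mul_zero]
      exact zero_le
  · rw [Set.indicator_of_notMem hw]
    exact zero_le

/-! ### Geodesics of the diamond with two segments -/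

theorem DiamondSpace.abs_fst_le (p : DiamondSpace) : |p.1.1| ≤ Real.pi / 2 :=
  (mem_diamond_union_segments_iff.1 p.2).1

theorem DiamondSpace.abs_snd_le (p : DiamondSpace) : |p.1.2| ≤ halfHeight p.1.1 :=
  (mem_diamond_union_segments_iff.1 p.2).2

/-- The curve from `p` to `paramSpace w` that is given by `fiberPath`. -/
noncomputable def fiberCurve (p : DiamondSpace) (w : paramRect) (t : unitInterval) :
    DiamondSpace :=
  paramSpace ⟨fiberPath p.1.1 p.1.2 t w, fiberPath_mem p.abs_snd_le p.abs_fst_le t.2.1 t.2.2 w.2⟩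

theorem dist_fiberCurve (p : DiamondSpace) (w : paramRect) (t t' : unitInterval) :
    dist (fiberCurve p w t) (fiberCurve p w t') =
      |(t' : ℝ) - t| * dist p (paramSpace w) :=
  dist_flatten_fiberPath p.abs_snd_le t.2.1 t.2.2 t'.2.1 t'.2.2 (mem_paramRect.1 w.2).2

theorem fiberCurve_zero (p : DiamondSpace) (w : paramRect) : fiberCurve p w 0 = p :=
  Subtype.ext (flatten_fiberPath_zero p.abs_snd_le w)

theorem fiberCurve_one (p : DiamondSpace) (w : paramRect) : fiberCurve p w 1 = paramSpace w :=
  Subtype.ext (congrArg flatten (fiberPath_one w.1))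

/-- `fiberCurve` as a geodesic. -/
noncomputable def fiberGeodesic (p : DiamondSpace) (w : paramRect) : Geo DiamondSpace :=
  ⟨⟨fiberCurve p w, (LipschitzWith.of_dist_le_mul (K := ⟨dist p (paramSpace w), dist_nonneg⟩)
      fun t t' => by
        rw [dist_fiberCurve, mul_comm, dist_comm t t']
        exact le_rfl).continuous⟩, fun t t' => by
    change dist (fiberCurve p w t) (fiberCurve p w t') =
      _ * dist (fiberCurve p w 0) (fiberCurve p w 1)
    rw [dist_fiberCurve, fiberCurve_zero, fiberCurve_one]⟩

theorem eval_fiberGeodesic (p : DiamondSpace) (w : paramRect) (t : unitInterval) :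
    (fiberGeodesic p w).eval t = fiberCurve p w t := rfl

theorem length_fiberGeodesic (p : DiamondSpace) (w : paramRect) :
    (fiberGeodesic p w).length = dist p (paramSpace w) := by
  rw [Geo.length, eval_fiberGeodesic, eval_fiberGeodesic, fiberCurve_zero, fiberCurve_one]

theorem measurable_fiberGeodesic (p : DiamondSpace) : Measurable (fiberGeodesic p) := by
  refine Geo.measurable_of_eval fun t => continuous_paramSpace.measurable.comp ?_
  exact ((measurable_fiberPath _ _ _).comp measurable_subtype_coe).subtype_mk

theorem paramSpace_surjective : Function.Surjective paramSpace := fun p => by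
  obtain ⟨w, hw, hwp⟩ := exists_flatten_eq p.2
  exact ⟨⟨w, hw⟩, Subtype.ext hwp⟩

theorem isGeodesicSpace_diamondSpace : IsGeodesicSpace DiamondSpace := fun p q => by
  obtain ⟨w, rfl⟩ := paramSpace_surjective q
  exact ⟨fiberGeodesic p w, fiberCurve_zero p w, fiberCurve_one p w⟩

theorem MCP_diamondSpace : MCP 2 3 DiamondSpace diamondMeasure := by
  refine ⟨Or.inl (by norm_num), fun p A hA hA0 hAtop _ => ?_⟩
  rw [diamondMeasure_eq_map] at hA0 hAtop ⊢
  refine exists_contraction continuous_paramSpace.measurable (measurable_fiberGeodesic p)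
    (fiberCurve_zero p) (fiberCurve_one p) (fun t B hB => ?_) hA hA0 hAtop
  obtain ⟨C, hC, rfl⟩ := hB
  have h := setLIntegral_contractionCoeff_le p.abs_snd_le p.abs_fst_le t.2.1 t.2.2
    (continuous_flatten.measurable hC)
  rw [Measure.map_apply continuous_paramSpace.measurable (measurable_subtype_coe hC)]
  simp only [length_fiberGeodesic]
  exact h

/-! ### Compactness, balls and diameter -/

instance : CompactSpace DiamondSpace := by
  refine isCompact_iff_compactSpace.1 (Metric.isCompact_of_isClosed_isBounded
    isClosed_diamond_union_segments ?_)
  refine (Metric.isBounded_closedBall (x := (0 : ℝ × ℝ)) (r := Real.pi)).subset fun p hp => ?_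
  have hpi := Real.pi_gt_three
  have h := mem_diamond_union_segments_iff.1 hp
  rw [mem_closedBall_zero_iff, Prod.norm_def, Real.norm_eq_abs, Real.norm_eq_abs]
  exact max_le (by linarith) (by linarith [halfHeight_le p.1])

/-- The rectangle is the closure of its interior, where the density is positive, so the preimage of
a nonempty open set contains a nonempty open set of positive measure. -/
theorem diamondMeasure_pos_of_isOpen {U : Set DiamondSpace} (hU : IsOpen U) (hne : U.Nonempty) :
    0 < diamondMeasure U := by
  obtain ⟨V, hV, rfl⟩ := hU
  obtain ⟨p, hp⟩ := hne
  obtain ⟨w, rfl⟩ := paramSpace_surjective p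
  have hW : IsOpen (flatten ⁻¹' V) := hV.preimage continuous_flatten
  have hint : interior paramRect =
      Set.Ioo (-(Real.pi / 2)) (Real.pi / 2) ×ˢ Set.Ioo (-1) 1 := by
    rw [paramRect, interior_prod_eq, interior_Icc, interior_Icc]
  have hcl : closure (interior paramRect) = paramRect := by
    have hpi := Real.pi_pos
    rw [hint, closure_prod_eq, closure_Ioo (by linarith), closure_Ioo (by norm_num), paramRect]
  obtain ⟨v, hvW, hvR⟩ : (flatten ⁻¹' V ∩ interior paramRect).Nonempty :=
    mem_closure_iff.1 (hcl.symm ▸ w.2 : w.1 ∈ closure (interior paramRect)) _ hW hp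
  rw [diamondMeasure_eq_map, Measure.map_apply continuous_paramSpace.measurable
    (measurable_subtype_coe hV.measurableSet), paramMeasure,
    comap_subtype_coe_apply measurableSet_paramRect, pos_iff_ne_zero]
  intro h0
  have hO : IsOpen (flatten ⁻¹' V ∩ interior paramRect) := hW.inter isOpen_interior
  have hsub : flatten ⁻¹' V ∩ interior paramRect ⊆
      Subtype.val '' (paramSpace ⁻¹' (Subtype.val ⁻¹' V)) :=
    fun x hx => ⟨⟨x, interior_subset hx.2⟩, hx.1, rfl⟩
  have h1 := measure_mono_null hsub h0
  rw [withDensity_apply_eq_zero measurable_paramDensity] at h1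
  have h2 : {x | paramDensity x ≠ 0} ∩ (flatten ⁻¹' V ∩ interior paramRect) =
      flatten ⁻¹' V ∩ interior paramRect := by
    refine Set.inter_eq_right.2 fun x hx => ?_
    rw [hint] at hx
    have : 0 < Real.cos x.1 := Real.cos_pos_of_mem_Ioo hx.2.1
    exact (ENNReal.ofReal_pos.2 (by positivity)).ne'
  rw [h2] at h1
  exact (hO.measure_pos volume ⟨v, hvW, hvR⟩).ne' h1

theorem isMetricMeasureSpace_diamondSpace :
    IsMetricMeasureSpace DiamondSpace diamondMeasure :=
  ⟨inferInstance, inferInstance, fun x _ hr =>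
    ⟨diamondMeasure_pos_of_isOpen Metric.isOpen_ball ⟨x, Metric.mem_ball_self hr⟩,
      measure_lt_top _ _⟩⟩

/-- The point of `Y` on the first axis over `x`. -/
noncomputable def axisPoint (x : ℝ) (hx : |x| ≤ Real.pi / 2) : DiamondSpace :=
  ⟨(x, 0), mem_diamond_union_segments_iff.2 ⟨hx, by simpa using halfHeight_nonneg x⟩⟩

theorem diam_diamondSpace : Metric.diam (Set.univ : Set DiamondSpace) = Real.pi := by
  have hpi := Real.pi_gt_three
  refine le_antisymm (Metric.diam_le_of_forall_dist_le (by linarith) fun p _ q _ => ?_) ?_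
  · rw [Subtype.dist_eq, Prod.dist_eq, Real.dist_eq, Real.dist_eq]
    refine max_le ((abs_sub _ _).trans (by linarith [p.abs_fst_le, q.abs_fst_le]))
      ((abs_sub _ _).trans ?_)
    linarith [p.abs_snd_le, q.abs_snd_le, halfHeight_le p.1.1, halfHeight_le q.1.1]
  · have h1 : |Real.pi / 2| ≤ Real.pi / 2 := by rw [abs_of_pos (by linarith)]
    have h2 : |-(Real.pi / 2)| ≤ Real.pi / 2 := by rwa [abs_neg]
    have h := Metric.dist_le_diam_of_mem (isCompact_univ (X := DiamondSpace)).isBounded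
      (Set.mem_univ (axisPoint _ h1)) (Set.mem_univ (axisPoint _ h2))
    refine le_trans ?_ h
    rw [Subtype.dist_eq, Prod.dist_eq, Real.dist_eq]
    refine le_trans ?_ (le_max_left _ _)
    refine le_trans (le_of_eq ?_) (le_abs_self _)
    simp only [axisPoint]
    ring

/-! ### Cut points of suspensions -/

namespace SphericalSuspension

variable {Z : Type*}

/-- The projection of `Z × [0, π]` to the suspension. -/
def mk (p : Z × Set.Icc (0 : ℝ) Real.pi) : SphericalSuspension Z := Quotient.mk _ p

theorem mk_surjective : Function.Surjective (mk : _ → SphericalSuspension Z) :=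
  Quotient.mk_surjective

theorem mk_eq_mk_iff {p q : Z × Set.Icc (0 : ℝ) Real.pi} : mk p = mk q ↔
    p = q ∨ ((p.2 : ℝ) = 0 ∧ (q.2 : ℝ) = 0) ∨ ((p.2 : ℝ) = Real.pi ∧ (q.2 : ℝ) = Real.pi) :=
  Quotient.eq (r := suspensionSetoid Z)

/-- The height coordinate of the suspension. -/
def height : SphericalSuspension Z → ℝ :=
  Quotient.lift (fun p : Z × Set.Icc (0 : ℝ) Real.pi => (p.2 : ℝ)) fun p q h => by
    rcases h with rfl | h | h
    · rfl
    · exact h.1.trans h.2.symm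
    · exact h.1.trans h.2.symm

theorem height_mk (p : Z × Set.Icc (0 : ℝ) Real.pi) : height (mk p) = p.2 := rfl

theorem height_injective [Subsingleton Z] :
    Function.Injective (height : SphericalSuspension Z → ℝ) := by
  intro x y h
  obtain ⟨p, rfl⟩ := mk_surjective x
  obtain ⟨q, rfl⟩ := mk_surjective y
  exact congrArg mk (Prod.ext (Subsingleton.elim _ _) (Subtype.ext h))

theorem eq_of_height_eq_zero {x y : SphericalSuspension Z} (hx : height x = 0)
    (hy : height y = 0) : x = y := by
  obtain ⟨p, rfl⟩ := mk_surjective x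
  obtain ⟨q, rfl⟩ := mk_surjective y
  exact mk_eq_mk_iff.2 (Or.inr (Or.inl ⟨hx, hy⟩))

theorem eq_of_height_eq_pi {x y : SphericalSuspension Z} (hx : height x = Real.pi)
    (hy : height y = Real.pi) : x = y := by
  obtain ⟨p, rfl⟩ := mk_surjective x
  obtain ⟨q, rfl⟩ := mk_surjective y
  exact mk_eq_mk_iff.2 (Or.inr (Or.inr ⟨hx, hy⟩))

variable [TopologicalSpace Z]

theorem continuous_mk : Continuous (mk : _ → SphericalSuspension Z) := continuous_quot_mk

theorem continuous_height : Continuous (height : SphericalSuspension Z → ℝ) :=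
  Continuous.quotient_lift (continuous_subtype_val.comp continuous_snd) _

theorem isPreconnected_image_mk (z : Z) {s : Set (Set.Icc (0 : ℝ) Real.pi)}
    (hs : s.OrdConnected) : IsPreconnected ((fun r => mk (z, r)) '' s) := by
  have : Fact ((0 : ℝ) ≤ Real.pi) := ⟨Real.pi_pos.le⟩
  exact hs.isPreconnected.image _
    (continuous_mk.comp (Continuous.prodMk_right z)).continuousOn

/-- Any point can be joined to the bottom pole while avoiding `x`: directly along its meridian if
that part misses `x`, otherwise up to the top pole and down another meridian. -/
theorem isPreconnected_compl_singleton [Nontrivial Z] {x : SphericalSuspension Z}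
    (h0 : height x ≠ 0) (hpi : height x ≠ Real.pi) :
    IsPreconnected ({x}ᶜ : Set (SphericalSuspension Z)) := by
  obtain ⟨⟨z, r⟩, rfl⟩ := mk_surjective x
  rw [height_mk] at h0 hpi
  obtain ⟨w, hw⟩ := exists_ne z
  let bot : Set.Icc (0 : ℝ) Real.pi := ⟨0, le_rfl, Real.pi_pos.le⟩
  let top : Set.Icc (0 : ℝ) Real.pi := ⟨Real.pi, Real.pi_pos.le, le_rfl⟩
  have hne : ∀ v r', v ≠ z ∨ r' ≠ r → mk (v, r') ≠ mk (z, r) := by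
    intro v r' h heq
    rcases mk_eq_mk_iff.1 heq with h' | h' | h'
    · rw [Prod.mk.injEq] at h'
      exact h.elim (fun h => h h'.1) (fun h => h h'.2)
    · exact h0 h'.2
    · exact hpi h'.2
  have hbot : ∀ v v' : Z, mk (v, bot) = mk (v', bot) := fun v v' =>
    eq_of_height_eq_zero rfl rfl
  have htop : ∀ v v' : Z, mk (v, top) = mk (v', top) := fun v v' =>
    eq_of_height_eq_pi rfl rfl
  have hcol : ∀ v ≠ z, (fun r' => mk (v, r')) '' Set.univ ⊆ {mk (z, r)}ᶜ := by
    rintro v hv _ ⟨r', -, rfl⟩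
    exact hne v r' (Or.inl hv)
  refine isPreconnected_of_forall (mk (w, bot)) fun y hy => ?_
  obtain ⟨⟨v, r'⟩, rfl⟩ := mk_surjective y
  by_cases hv : v = z
  · subst hv
    have hr' : r' ≠ r := fun h => hy (by rw [h]; rfl)
    rcases lt_or_gt_of_ne hr' with hlt | hgt
    · refine ⟨(fun r' => mk (v, r')) '' Set.Iio r, ?_, ⟨bot, ?_, hbot _ _⟩, ⟨r', hlt, rfl⟩,
        isPreconnected_image_mk v Set.ordConnected_Iio⟩
      · rintro _ ⟨r'', hr'', rfl⟩
        exact hne v r'' (Or.inr (ne_of_lt hr''))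
      · exact (show (0 : ℝ) < r from lt_of_le_of_ne r.2.1 (Ne.symm h0))
    · refine ⟨(fun r' => mk (w, r')) '' Set.univ ∪ (fun r' => mk (v, r')) '' Set.Ioi r,
        Set.union_subset (hcol w hw) ?_, Or.inl ⟨bot, trivial, rfl⟩, Or.inr ⟨r', hgt, rfl⟩,
        IsPreconnected.union (mk (w, top)) ⟨top, trivial, rfl⟩ ⟨top, ?_, htop _ _⟩
          (isPreconnected_image_mk w Set.ordConnected_univ)
          (isPreconnected_image_mk v Set.ordConnected_Ioi)⟩
      · rintro _ ⟨r'', hr'', rfl⟩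
        exact hne v r'' (Or.inr (ne_of_gt hr''))
      · exact (show (r : ℝ) < Real.pi from lt_of_le_of_ne r.2.2 hpi)
  · exact ⟨_, hcol v hv, ⟨bot, trivial, hbot _ _⟩, ⟨r', trivial, rfl⟩,
      isPreconnected_image_mk v Set.ordConnected_univ⟩

end SphericalSuspension

/-- There is no continuous injection of the plane into the line. -/
theorem not_injective_of_continuous {g : ℝ × ℝ → ℝ} (hg : Continuous g) :
    ¬Function.Injective g := by
  intro hinj
  have hmid : ∀ p q r : ℝ × ℝ, g p < g q → g q < g r → False := by
    intro p q r hpq hqr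
    -- A punctured plane is connected, so its image is order connected and attains the intermediate
    -- value `g q` a second time. Among three distinct points one must have the middle value.
    have hconn : IsPreconnected ({q}ᶜ : Set (ℝ × ℝ)) :=
      (isConnected_compl_singleton_of_one_lt_rank (by
        rw [rank_prod', Module.rank_self]
        exact_mod_cast (by norm_num : 1 < 1 + 1)) q).isPreconnected
    obtain ⟨x, hx, hxq⟩ := (hconn.image g hg.continuousOn).ordConnected.out
      ⟨p, fun h => hpq.ne (congrArg g h), rfl⟩ ⟨r, fun h => hqr.ne' (congrArg g h), rfl⟩
      ⟨hpq.le, hqr.le⟩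
    exact hx (hinj hxq)
  have h01 : g (0, 0) ≠ g (1, 0) := fun h => by simpa using hinj h
  have h02 : g (0, 0) ≠ g (2, 0) := fun h => by simpa using hinj h
  have h12 : g (1, 0) ≠ g (2, 0) := fun h => by simpa using hinj h
  rcases h01.lt_or_gt with h | h <;> rcases h02.lt_or_gt with h' | h' <;>
    rcases h12.lt_or_gt with h'' | h''
  · exact hmid _ _ _ h h''
  · exact hmid _ _ _ h' h''
  · exact (lt_asymm h (h''.trans h')).elim
  · exact hmid _ _ _ h' h
  · exact hmid _ _ _ h h'
  · exact lt_asymm h' (h''.trans h)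
  · exact hmid _ _ _ h'' h'
  · exact hmid _ _ _ h'' h

/-- The slice of `Y` over such an `x` is a single point, so without it the first coordinate skips
the value `x` while still taking values on both sides. -/
theorem not_isPreconnected_compl_axisPoint {x : ℝ} (hx : 1 / 4 ≤ x) (hx' : x < Real.pi / 2)
    (h : |x| ≤ Real.pi / 2) : ¬IsPreconnected ({axisPoint x h}ᶜ : Set DiamondSpace) := by
  intro hconn
  have hpi := Real.pi_gt_three
  have h0 : |(0 : ℝ)| ≤ Real.pi / 2 := by simp; positivity
  have h1 : |Real.pi / 2| ≤ Real.pi / 2 := by rw [abs_of_pos (by linarith)]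
  have hne : ∀ y hy, y ≠ x → axisPoint y hy ∈ ({axisPoint x h}ᶜ : Set DiamondSpace) :=
    fun y hy hyx heq => hyx (congrArg (fun p : DiamondSpace => p.1.1) heq)
  have hcont : Continuous fun p : DiamondSpace => p.1.1 := by fun_prop
  obtain ⟨p, hp, hpx⟩ := (hconn.image _ hcont.continuousOn).ordConnected.out
    ⟨_, hne 0 h0 (by linarith), rfl⟩ ⟨_, hne _ h1 hx'.ne', rfl⟩
    (show x ∈ Set.Icc 0 (Real.pi / 2) from ⟨by linarith, hx'.le⟩)
  refine hp (Subtype.ext (Prod.ext hpx ?_))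
  have hs := p.abs_snd_le
  change p.1.1 = x at hpx
  rw [hpx, halfHeight_of_le_abs (by rwa [abs_of_pos (by linarith)])] at hs
  exact abs_nonpos_iff.1 hs

theorem not_isTopologicalSphericalSuspension_diamondSpace :
    ¬IsTopologicalSphericalSuspension DiamondSpace := by
  rintro ⟨Z, _, ⟨e⟩⟩
  have hpi := Real.pi_gt_three
  rcases subsingleton_or_nontrivial Z with hZ | hZ
  -- A copy of the plane inside the diamond: `|arctan| ≤ 2` and `9 * 2 / 100 ≤ 1/4 - 2 / 100`.
  · have hmem : ∀ p : ℝ × ℝ,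
        (Real.arctan p.1 / 100, Real.arctan p.2 / 100) ∈ diamond ∪ segments := by
      intro p
      have hb : ∀ y, |Real.arctan y| ≤ 2 := fun y => abs_le.2
        ⟨by linarith [Real.neg_pi_div_two_lt_arctan y, Real.pi_lt_four],
          by linarith [Real.arctan_lt_pi_div_two y, Real.pi_lt_four]⟩
      refine Or.inl (mem_diamond_iff.2 ?_)
      rw [abs_div, abs_div, abs_of_pos (show (0 : ℝ) < 100 by norm_num)]
      linarith [hb p.1, hb p.2]
    have hf : Continuous fun p : ℝ × ℝ => (⟨_, hmem p⟩ : DiamondSpace) := by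
      refine Continuous.subtype_mk ?_ _
      exact ((Real.continuous_arctan.comp continuous_fst).div_const _).prodMk
        ((Real.continuous_arctan.comp continuous_snd).div_const _)
    refine not_injective_of_continuous
      (SphericalSuspension.continuous_height.comp (e.continuous.comp hf))
      (SphericalSuspension.height_injective.comp (e.injective.comp fun p q hpq => ?_))
    have h := congrArg Subtype.val hpq
    simp only [Prod.mk.injEq] at h
    exact Prod.ext (Real.arctan_injective (by linarith [h.1]))
      (Real.arctan_injective (by linarith [h.2]))
  · have habs : ∀ x : ℝ, 1 / 4 ≤ x → x < Real.pi / 2 → |x| ≤ Real.pi / 2 := fun x hx hx' => by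
      rw [abs_of_pos (by linarith)]
      exact hx'.le
    have hpole : ∀ x (hx : 1 / 4 ≤ x) (hx' : x < Real.pi / 2),
        SphericalSuspension.height (e (axisPoint x (habs x hx hx'))) = 0 ∨
        SphericalSuspension.height (e (axisPoint x (habs x hx hx'))) = Real.pi := by
      intro x hx hx'
      by_contra! h
      have hconn := SphericalSuspension.isPreconnected_compl_singleton h.1 h.2
      refine not_isPreconnected_compl_axisPoint hx hx' (habs x hx hx') ?_
      have := (e.isPreconnected_preimage).2 hconn
      rwa [Set.preimage_compl, ← Set.image_singleton, e.injective.preimage_image] at this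
    have hinj : ∀ x y hx hy, e (axisPoint x hx) = e (axisPoint y hy) → x = y :=
      fun x y hx hy h => congrArg (fun p : DiamondSpace => p.1.1) (e.injective h)
    -- Three distinct cut points cannot all be among the two poles.
    have h1 := hpole (1 / 2) (by norm_num) (by linarith)
    have h2 := hpole (3 / 4) (by norm_num) (by linarith)
    have h3 := hpole 1 (by norm_num) (by linarith)
    have key : ∀ x y hx hy, x ≠ y →
        (SphericalSuspension.height (e (axisPoint x hx)) = 0 →
          SphericalSuspension.height (e (axisPoint y hy)) ≠ 0) ∧
        (SphericalSuspension.height (e (axisPoint x hx)) = Real.pi →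
          SphericalSuspension.height (e (axisPoint y hy)) ≠ Real.pi) :=
      fun x y hx hy hxy =>
        ⟨fun h h' => hxy (hinj _ _ _ _ (SphericalSuspension.eq_of_height_eq_zero h h')),
          fun h h' => hxy (hinj _ _ _ _ (SphericalSuspension.eq_of_height_eq_pi h h'))⟩
    have k12 := key (1 / 2) (3 / 4) (habs _ (by norm_num) (by linarith))
      (habs _ (by norm_num) (by linarith)) (by norm_num)
    have k13 := key (1 / 2) 1 (habs _ (by norm_num) (by linarith))
      (habs _ (by norm_num) (by linarith)) (by norm_num)
    have k23 := key (3 / 4) 1 (habs _ (by norm_num) (by linarith))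
      (habs _ (by norm_num) (by linarith)) (by norm_num)
    tauto

theorem mainTheorem1 :
    CompactSpace DiamondSpace ∧
    IsGeodesicSpace DiamondSpace ∧
    IsMetricMeasureSpace DiamondSpace diamondMeasure ∧
    diamondMeasure.map (fun p : DiamondSpace => p.1.1) =
      ((volume : Measure ℝ).restrict (Set.Icc (-(Real.pi / 2)) (Real.pi / 2))).withDensity
        (fun x => ENNReal.ofReal (Real.cos x ^ 2)) ∧
    MCP 2 3 DiamondSpace diamondMeasure ∧
    Metric.diam (Set.univ : Set DiamondSpace) = Real.pi ∧
    ¬ IsTopologicalSphericalSuspension DiamondSpace :=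
  ⟨inferInstance, isGeodesicSpace_diamondSpace, isMetricMeasureSpace_diamondSpace,
    diamondMeasure_map_fst, MCP_diamondSpace, diam_diamondSpace,
    not_isTopologicalSphericalSuspension_diamondSpace⟩
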